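/- Let $M$ be a smooth finite-dimensional Riemannian manifold (without boundary) which is complete, and let $\nabla$ denote covariant differentiation along curves with respect to the Levi-Civita connection. Let $p \in M$, let $x, y \in T_pM$ be an orthonormal pair of tangent vectors, and let $\kappa \colon \mathbb{R} \to \mathbb{R}$ be a smooth function. Then there exists a unique smooth unit-speed curve $\gamma \colon \mathbb{R} \to M$, with tangent vector field $T = \gamma'$, for which there is a smooth unit vector field $Y$ along $\gamma$ such that $$\nabla_T T = \kappa Y, \qquad \nabla_T Y = -\kappa T \qquad \text{on all of } \mathbb{R},$$ and $$\gamma(0) = p, \qquad T(0) = x, \qquad Y(0) = y.$$ Moreover, the vector field $Y$ along $\gamma$ is also unique. (A smooth unit-speed curve $\gamma$ for which such a unit field $Y$ and smooth function $\kappa$ exist is called a planar curve.) -/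

import Mathlib

open Bundle
open scoped Manifold ContDiff

noncomputable section

namespace PlanarCurve

/-! Throughout, `M` is a manifold without boundary modelled on a finite-dimensional real vector
space `E`, with a Riemannian metric on its tangent bundle. -/

variable {E : Type*} [NormedAddCommGroup E] [NormedSpace ℝ E]
  {M : Type*} [TopologicalSpace M] [ChartedSpace E M]

section Connection

variable [RiemannianBundle (fun q : M => TangentSpace 𝓘(ℝ, E) q)]

/-- The Riemannian metric in the coordinates of the chart `φ` at `c`: for `z` in the target of `φ`,
`g_z(v, w) = ⟨d(φ⁻¹)_z v, d(φ⁻¹)_z w⟩`. -/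
def chartMetric (c : M) (z : E) : E →L[ℝ] E →L[ℝ] ℝ :=
  (innerSL ℝ (E := TangentSpace 𝓘(ℝ, E) ((extChartAt 𝓘(ℝ, E) c).symm z))).bilinearComp
    (mfderiv 𝓘(ℝ, E) 𝓘(ℝ, E) (extChartAt 𝓘(ℝ, E) c).symm z)
    (mfderiv 𝓘(ℝ, E) 𝓘(ℝ, E) (extChartAt 𝓘(ℝ, E) c).symm z)

/-- Christoffel symbols of the first kind in the chart at `c`, as the linear form
`u ↦ ½ (∂_v g(w, u) + ∂_w g(v, u) - ∂_u g(v, w))`. -/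
def christoffelFirst (c : M) (z v w : E) : E →L[ℝ] ℝ :=
  (1 / 2 : ℝ) • (fderiv ℝ (chartMetric c) z v w + fderiv ℝ (chartMetric c) z w v
    - ((fderiv ℝ (chartMetric c) z).flip v).flip w)

/-- Christoffel symbols of the Levi-Civita connection in the chart at `c`:
`Γ_z(v, w)` is the vector with `g_z(Γ_z(v, w), u) = christoffelFirst c z v w u` for all `u`,
that is, the first-kind symbol with its index raised by the inverse of the metric. -/
def christoffel (c : M) (z v w : E) : E :=
  (chartMetric c z).inverse (christoffelFirst c z v w)

/-- The coordinate expression, in the chart `φ` at `c`, of a vector field `V` along `γ`: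
`s ↦ dφ_{γ(s)} V(s)`. -/
def chartField (c : M) (γ : ℝ → M) (V : ∀ t, TangentSpace 𝓘(ℝ, E) (γ t)) (s : ℝ) : E :=
  mfderiv 𝓘(ℝ, E) 𝓘(ℝ, E) (extChartAt 𝓘(ℝ, E) c) (γ s) (V s)

/-- The covariant derivative along `γ`, with respect to the Levi-Civita connection, of a vector
field `V` along `γ`. In the chart `φ` at `γ t` it is `V' + Γ(γ', V)`; this vector of `E` is carried
back to the tangent space at `γ t` by the inverse of `dφ`. -/
def covDerivAlong (γ : ℝ → M) (V : ∀ t, TangentSpace 𝓘(ℝ, E) (γ t)) (t : ℝ) :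
    TangentSpace 𝓘(ℝ, E) (γ t) :=
  (mfderiv 𝓘(ℝ, E) 𝓘(ℝ, E) (extChartAt 𝓘(ℝ, E) (γ t)) (γ t)).inverse
    (deriv (chartField (γ t) γ V) t
      + christoffel (γ t) (extChartAt 𝓘(ℝ, E) (γ t) (γ t))
          (deriv (fun s => extChartAt 𝓘(ℝ, E) (γ t) (γ s)) t) (chartField (γ t) γ V t))

end Connection

variable (E) in
/-- The tangent vector field `T` of a curve. -/
def velocity (γ : ℝ → M) (t : ℝ) : TangentSpace 𝓘(ℝ, E) (γ t) :=
  mfderiv 𝓘(ℝ, ℝ) 𝓘(ℝ, E) γ t (1 : ℝ)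

variable [IsManifold 𝓘(ℝ, E) ∞ M] [RiemannianBundle (fun q : M => TangentSpace 𝓘(ℝ, E) q)]

/-- `γ : ℝ → M` is a planar curve, with unit field `Y` along it and function `κ`: it is smooth and
of unit speed, `Y` is smooth and of unit length, and, with `T` the tangent vector field of `γ`,
`∇_T T = κ Y` and `∇_T Y = -κ T`. -/
structure IsPlanarWith (κ : ℝ → ℝ) (γ : ℝ → M) (Y : ∀ t, TangentSpace 𝓘(ℝ, E) (γ t)) :
    Prop where
  smooth : ContMDiff 𝓘(ℝ, ℝ) 𝓘(ℝ, E) ∞ γ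
  unit_speed : ∀ t, ‖velocity E γ t‖ = 1
  smooth_field : ContMDiff 𝓘(ℝ, ℝ) 𝓘(ℝ, E).tangent ∞
    (fun t => (⟨γ t, Y t⟩ : TangentBundle 𝓘(ℝ, E) M))
  unit_field : ∀ t, ‖Y t‖ = 1
  covDeriv_velocity : ∀ t, covDerivAlong γ (velocity E γ) t = κ t • Y t
  covDeriv_field : ∀ t, covDerivAlong γ Y t = -κ t • velocity E γ t

/-- The initial conditions `γ(0) = p`, `T(0) = x`, `Y(0) = y`, for tangent vectors `x`, `y` at `p`.
Equality in the tangent bundle comprises equality of the base points. -/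
structure HasInitialData (p : M) (x y : TangentSpace 𝓘(ℝ, E) p)
    (γ : ℝ → M) (Y : ∀ t, TangentSpace 𝓘(ℝ, E) (γ t)) : Prop where
  base : γ 0 = p
  velocity_zero : (⟨γ 0, velocity E γ 0⟩ : TangentBundle 𝓘(ℝ, E) M) = ⟨p, x⟩
  field_zero : (⟨γ 0, Y 0⟩ : TangentBundle 𝓘(ℝ, E) M) = ⟨p, y⟩

end PlanarCurve

end

/-!
A planar curve is determined by a first-order system for the triple `(γ, T, Y)`. In a chart, with
`z` the coordinates of `γ` and `v`, `w` those of `T` and `Y`, the conditions `γ' = T`,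
`∇_T T = κ Y`, `∇_T Y = -κ T` read
`z' = v`, `v' = κ w - Γ_z(v, v)`, `w' = -κ v - Γ_z(v, w)` (`frenetField`).
The transformation law of the Christoffel symbols (`fderiv_transition_christoffel`) shows that the
system does not depend on the chart (`hasDerivAt_stateCoord_change`), so that it makes sense to say
that `(γ, T, Y)` solves it on a set of times (`IsFrenetOn`); planar curves are the solutions on `ℝ`
that start at an orthonormal pair (`IsPlanarWith.isFrenetOn`, `IsFrenetOn.isPlanarWith`).

Uniqueness is that of the Cauchy problem, propagated along intervals by a connectedness argument
(`IsFrenetOn.eqOn`).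

For existence, metric compatibility gives `⟨T, T⟩' = 2κ⟨T, Y⟩`, `⟨Y, Y⟩' = -2κ⟨T, Y⟩` and
`⟨T, Y⟩' = κ(⟨Y, Y⟩ - ⟨T, T⟩)`, whence `T` and `Y` remain unit vectors when they start as an
orthonormal pair (`IsFrenetOn.tangentInner_self_eq_one`). Therefore `γ` is `1`-Lipschitz and, on a
complete manifold, converges to some point `q` at any finite end of its interval of definition. Near
`q` the coordinates of unit vectors stay in a compact set, on which solutions have a common lifespan
(`exists_isFrenetOn_uniform`); so the solution extends beyond that end, and the union of all
intervals of definition is both open and closed (`exists_isFrenetOn_univ`).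

The tangent spaces are all definitionally the model space `E`. Tangent vectors are handled below as
elements of `E`, and `chartDeriv`, `chartSymmDeriv`, `tangentInner`, `modelVelocity` are the
corresponding versions of the derivatives of charts, the metric and the tangent field.
-/

noncomputable section

namespace PlanarCurve

open Set Filter Metric Function
open scoped Topology NNReal

set_option maxSynthPendingDepth 3

/-! ### Ordinary differential equations -/

section ODE

variable {X : Type*} [NormedAddCommGroup X] [NormedSpace ℝ X]

/-- Local uniqueness for a time-dependent field that is `C¹` near the initial time and point. -/
theorem ode_unique_eventually {f : ℝ → X → X} {t₀ : ℝ} {α β : ℝ → X}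
    (hf : ContDiffAt ℝ 1 (uncurry f) (t₀, α t₀))
    (hα : ∀ᶠ t in 𝓝 t₀, HasDerivAt α (f t (α t)) t)
    (hβ : ∀ᶠ t in 𝓝 t₀, HasDerivAt β (f t (β t)) t) (h : α t₀ = β t₀) :
    α =ᶠ[𝓝 t₀] β := by
  obtain ⟨K, s, hs, hl⟩ := hf.exists_lipschitzOnWith
  obtain ⟨T, hT, U, hU, hTU⟩ := mem_nhds_prod_iff.1 hs
  have hv : ∀ᶠ t in 𝓝 t₀, LipschitzOnWith K (f t) U := by
    filter_upwards [hT] with t ht x hx y hy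
    simpa [Prod.edist_eq] using hl (hTU (mk_mem_prod ht hx)) (hTU (mk_mem_prod ht hy))
  have hαU : ∀ᶠ t in 𝓝 t₀, α t ∈ U := hα.self_of_nhds.continuousAt.eventually_mem hU
  have hβU : ∀ᶠ t in 𝓝 t₀, β t ∈ U :=
    hβ.self_of_nhds.continuousAt.eventually_mem (by rwa [← h])
  exact ODE_solution_unique_of_eventually hv (hα.and hαU) (hβ.and hβU) h

theorem ode_contDiffAt [CompleteSpace X] {f : ℝ → X → X} {Ω : Set X}
    (hf : ContDiffOn ℝ ∞ (uncurry f) (univ ×ˢ Ω)) {t₀ : ℝ} {α : ℝ → X}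
    (hα : ∀ᶠ t in 𝓝 t₀, α t ∈ Ω ∧ HasDerivAt α (f t (α t)) t) : ContDiffAt ℝ ∞ α t₀ := by
  obtain ⟨ε, hε, h⟩ := (nhds_basis_closedBall.eventually_iff).1 hα
  rw [Real.closedBall_eq_Icc] at h
  refine (ODE.contDiffOn_enat_Icc_of_hasDerivWithinAt (n := ⊤) (u := Ω)
    (hf.mono (prod_mono_left (subset_univ _)))
    (fun t ht => (h ht).2.hasDerivWithinAt) fun t ht => (h ht).1).contDiffAt
    (Icc_mem_nhds (by linarith) (by linarith))

/-- The Picard–Lindelöf theorem, with the solution staying in the ball on which the field is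
controlled. -/
theorem exists_hasDerivAt_mem_closedBall_of_isPicardLindelof [CompleteSpace X] {f : ℝ → X → X}
    {tmin tmax : ℝ} {t₀ : Icc tmin tmax} {x₀ x : X} {a r L K : ℝ≥0}
    (hp : IsPicardLindelof f t₀ x₀ a r L K) (hx : x ∈ closedBall x₀ r) :
    ∃ α : ℝ → X, α t₀ = x ∧ ∀ t ∈ Ioo tmin tmax,
      α t ∈ closedBall x₀ a ∧ HasDerivAt α (f t (α t)) t := by
  obtain ⟨α, hα⟩ := ODE.FunSpace.exists_isFixedPt_next hp hx
  refine ⟨α.compProj, by rw [ODE.FunSpace.compProj_val, ← hα, ODE.FunSpace.next_apply₀],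
    fun t ht => ⟨α.compProj_mem_closedBall hp.mul_max_le, ?_⟩⟩
  have hd : HasDerivWithinAt α.compProj (f t (α.compProj t)) (Icc tmin tmax) t := by
    apply ODE.hasDerivWithinAt_picard_Icc (u := closedBall x₀ a) t₀.2 hp.continuousOn_uncurry
      α.continuous_compProj.continuousOn (fun _ _ => α.compProj_mem_closedBall hp.mul_max_le) x
      (Ioo_subset_Icc_self ht) |>.congr_of_mem _ (Ioo_subset_Icc_self ht)
    intro t' ht'
    nth_rw 1 [← hα]
    rw [ODE.FunSpace.compProj_of_mem ht', ODE.FunSpace.next_apply]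
  exact hd.hasDerivAt (Icc_mem_nhds ht.1 ht.2)

/-- Local existence for a `C¹` time-dependent field, with a lifespan that does not depend on the
initial time and point near a given one, the solution staying in the domain of the field. -/
theorem ode_exists_local [CompleteSpace X] {f : ℝ → X → X} {Ω : Set X}
    (hΩ : IsOpen Ω) (hf : ContDiffOn ℝ 1 (uncurry f) (univ ×ˢ Ω)) {s₀ : ℝ} {x₀ : X}
    (hx₀ : x₀ ∈ Ω) :
    ∃ S ∈ 𝓝 (s₀, x₀), ∃ ε > 0, ∀ q ∈ S, ∃ α : ℝ → X, α q.1 = q.2 ∧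
      ∀ t ∈ Ioo (q.1 - ε) (q.1 + ε), α t ∈ Ω ∧ HasDerivAt α (f t (α t)) t := by
  have hf₀ : ContDiffAt ℝ 1 (uncurry f) (s₀, x₀) :=
    hf.contDiffAt ((isOpen_univ.prod hΩ).mem_nhds (mk_mem_prod (mem_univ _) hx₀))
  obtain ⟨K, s, hs, hl⟩ := hf₀.exists_lipschitzOnWith
  have hb : ∀ᶠ q in 𝓝 (s₀, x₀), ‖uncurry f q‖ < ‖f s₀ x₀‖ + 1 :=
    hf₀.continuousAt.norm.eventually_lt_const (lt_add_one _)
  have hW : s ∩ {q | ‖uncurry f q‖ < ‖f s₀ x₀‖ + 1} ∩ univ ×ˢ Ω ∈ 𝓝 (s₀, x₀) :=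
    inter_mem (inter_mem hs hb) ((isOpen_univ.prod hΩ).mem_nhds (mk_mem_prod (mem_univ _) hx₀))
  obtain ⟨a, ha, haW⟩ := nhds_basis_closedBall.mem_iff.1 hW
  rw [← closedBall_prod_same] at haW
  lift a to ℝ≥0 using ha.le
  set L : ℝ≥0 := ⟨‖f s₀ x₀‖ + 1, by positivity⟩ with hL
  have hL1 : (0 : ℝ) < L := by rw [hL]; change 0 < ‖f s₀ x₀‖ + 1; positivity
  set ε : ℝ := min (a / 2) (a / 2 / L) with hεdef
  have hε : 0 < ε := by positivity
  have hε1 : ε ≤ a / 2 := min_le_left _ _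
  have hε2 : L * ε ≤ a / 2 := by
    calc (L : ℝ) * ε ≤ L * (a / 2 / L) := by gcongr; exact min_le_right _ _
      _ = a / 2 := by field_simp
  refine ⟨closedBall s₀ (a / 2) ×ˢ closedBall x₀ (a / 2),
    prod_mem_nhds (closedBall_mem_nhds _ (by positivity)) (closedBall_mem_nhds _ (by positivity)),
    ε, hε, ?_⟩
  rintro ⟨t₀, x⟩ ⟨ht₀, hx⟩
  have hI : ∀ t ∈ Icc (t₀ - ε) (t₀ + ε), t ∈ closedBall s₀ a := by
    intro t ht
    simp only [Real.closedBall_eq_Icc, mem_Icc] at ht ht₀ ⊢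
    constructor <;> linarith [ht.1, ht.2, ht₀.1, ht₀.2]
  have hp : IsPicardLindelof f (tmin := t₀ - ε) (tmax := t₀ + ε)
      ⟨t₀, by simp [hε.le]⟩ x₀ a (a / 2) L K := by
    refine ⟨fun t ht y hy z hz => ?_, fun y hy => ?_, fun t ht y hy => ?_, ?_⟩
    · simpa [Prod.edist_eq] using
        hl (haW (mk_mem_prod (hI t ht) hy)).1.1 (haW (mk_mem_prod (hI t ht) hz)).1.1
    · have := hl.continuousOn.comp (f := fun t : ℝ => (t, y)) (s := Icc (t₀ - ε) (t₀ + ε))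
        (by fun_prop) fun t ht => (haW (mk_mem_prod (hI t ht) hy)).1.1
      exact this
    · exact le_of_lt (haW (mk_mem_prod (hI t ht) hy)).1.2
    · change (L : ℝ) * max (t₀ + ε - t₀) (t₀ - (t₀ - ε)) ≤ a - ((a / 2 : ℝ≥0) : ℝ)
      push_cast
      simp only [add_sub_cancel_left, sub_sub_cancel, max_self]
      linarith
  obtain ⟨α, hα, hα'⟩ := exists_hasDerivAt_mem_closedBall_of_isPicardLindelof hp (x := x)
    (by simpa using hx)
  refine ⟨α, hα, fun t ht => ⟨?_, (hα' t ht).2⟩⟩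
  exact (haW (mk_mem_prod (hI t (Ioo_subset_Icc_self ht)) (hα' t ht).1)).2.2

/-- Solutions with initial times and points in a compact set have a common lifespan. -/
theorem ode_exists_uniform [CompleteSpace X] {f : ℝ → X → X} {Ω : Set X}
    (hΩ : IsOpen Ω) (hf : ContDiffOn ℝ 1 (uncurry f) (univ ×ˢ Ω)) {S : Set (ℝ × X)}
    (hS : IsCompact S) (hSΩ : ∀ q ∈ S, q.2 ∈ Ω) :
    ∃ ε > 0, ∀ q ∈ S, ∃ α : ℝ → X, α q.1 = q.2 ∧
      ∀ t ∈ Ioo (q.1 - ε) (q.1 + ε), α t ∈ Ω ∧ HasDerivAt α (f t (α t)) t := by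
  refine hS.induction_on (p := fun S => ∃ ε > 0, ∀ q ∈ S, ∃ α : ℝ → X, α q.1 = q.2 ∧
      ∀ t ∈ Ioo (q.1 - ε) (q.1 + ε), α t ∈ Ω ∧ HasDerivAt α (f t (α t)) t)
    ⟨1, one_pos, by simp⟩ ?_ ?_ ?_
  · rintro s t hst ⟨ε, hε, h⟩
    exact ⟨ε, hε, fun q hq => h q (hst hq)⟩
  · rintro s t ⟨ε, hε, h⟩ ⟨δ, hδ, h'⟩
    refine ⟨min ε δ, lt_min hε hδ, fun q hq => ?_⟩
    have h₁ := min_le_left ε δ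
    have h₂ := min_le_right ε δ
    rcases hq with hq | hq
    · obtain ⟨α, hα, hα'⟩ := h q hq
      exact ⟨α, hα, fun t ht => hα' t (Ioo_subset_Ioo (by linarith) (by linarith) ht)⟩
    · obtain ⟨α, hα, hα'⟩ := h' q hq
      exact ⟨α, hα, fun t ht => hα' t (Ioo_subset_Ioo (by linarith) (by linarith) ht)⟩
  · rintro ⟨t, x⟩ hx
    obtain ⟨T, hT, h⟩ := ode_exists_local hΩ hf (s₀ := t) (hSΩ _ hx)
    exact ⟨T, mem_nhdsWithin_of_mem_nhds hT, h⟩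

end ODE

/-! ### Derivatives of forms and of charts -/

section Charts

theorem fderiv_form_apply {E F : Type*} [NormedAddCommGroup E] [NormedSpace ℝ E]
    [NormedAddCommGroup F] [NormedSpace ℝ F] {B : E → F →L[ℝ] F →L[ℝ] ℝ} {u w : E → F} {z : E}
    (hB : DifferentiableAt ℝ B z) (hu : DifferentiableAt ℝ u z) (hw : DifferentiableAt ℝ w z)
    (a : E) :
    fderiv ℝ (fun x => B x (u x) (w x)) z a = fderiv ℝ B z a (u z) (w z)
      + B z (fderiv ℝ u z a) (w z) + B z (u z) (fderiv ℝ w z a) := by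
  have h1 : HasFDerivAt (fun x => B x (u x)) _ z := hB.hasFDerivAt.clm_apply hu.hasFDerivAt
  have h2 := (h1.clm_apply hw.hasFDerivAt).fderiv
  rw [h2]
  simp
  ring

/-- The derivative of a form `g = ψ^* g'` in terms of that of `g'`. Contracted as in the first
Christoffel symbols, it gives their transformation law. -/
theorem fderiv_pullback_form {E F : Type*} [NormedAddCommGroup E] [NormedSpace ℝ E]
    [NormedAddCommGroup F] [NormedSpace ℝ F]
    {g : E → E →L[ℝ] E →L[ℝ] ℝ} {g' : F → F →L[ℝ] F →L[ℝ] ℝ} {ψ : E → F} {z : E}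
    (hg : DifferentiableAt ℝ g z) (hg' : DifferentiableAt ℝ g' (ψ z)) (hψ : ContDiffAt ℝ 2 ψ z)
    (h : ∀ᶠ x in 𝓝 z, ∀ v w, g x v w = g' (ψ x) (fderiv ℝ ψ x v) (fderiv ℝ ψ x w)) (a v w : E) :
    fderiv ℝ g z a v w = fderiv ℝ g' (ψ z) (fderiv ℝ ψ z a) (fderiv ℝ ψ z v) (fderiv ℝ ψ z w)
      + g' (ψ z) (fderiv ℝ (fderiv ℝ ψ) z a v) (fderiv ℝ ψ z w)
      + g' (ψ z) (fderiv ℝ ψ z v) (fderiv ℝ (fderiv ℝ ψ) z a w) := by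
  have hψ1 : DifferentiableAt ℝ ψ z := hψ.differentiableAt (by simp)
  have hψ2 : DifferentiableAt ℝ (fderiv ℝ ψ) z :=
    (hψ.fderiv_right (m := 1) (by norm_num)).differentiableAt (by simp)
  have hψv : ∀ v, DifferentiableAt ℝ (fun x => fderiv ℝ ψ x v) z :=
    fun v => hψ2.clm_apply (differentiableAt_const v)
  have hψv' : ∀ v a, fderiv ℝ (fun x => fderiv ℝ ψ x v) z a = fderiv ℝ (fderiv ℝ ψ) z a v := by
    intro v a
    rw [fderiv_clm_apply hψ2 (differentiableAt_const v)]
    simp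
  have hl := fderiv_form_apply hg (differentiableAt_const v) (differentiableAt_const w) a
  have hgψ : HasFDerivAt (fun x => g' (ψ x)) ((fderiv ℝ g' (ψ z)).comp (fderiv ℝ ψ z)) z :=
    HasFDerivAt.comp (𝕜 := ℝ) (G := F →L[ℝ] F →L[ℝ] ℝ) z hg'.hasFDerivAt hψ1.hasFDerivAt
  have hr := fderiv_form_apply hgψ.differentiableAt (hψv v) (hψv w) a
  have he : (fun x => g x v w) =ᶠ[𝓝 z]
      fun x => g' (ψ x) (fderiv ℝ ψ x v) (fderiv ℝ ψ x w) := h.mono fun x hx => hx v w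
  rw [he.fderiv_eq, hr, hgψ.fderiv, hψv', hψv'] at hl
  simpa using hl.symm

variable {E : Type*} [NormedAddCommGroup E] [NormedSpace ℝ E]
  {M : Type*} [TopologicalSpace M] [ChartedSpace E M] [IsManifold 𝓘(ℝ, E) ∞ M]

theorem contMDiffAt_extChartAt_symm' {c : M} {z : E} (hz : z ∈ (extChartAt 𝓘(ℝ, E) c).target) :
    ContMDiffAt 𝓘(ℝ, E) 𝓘(ℝ, E) ∞ (extChartAt 𝓘(ℝ, E) c).symm z :=
  (contMDiffOn_extChartAt_symm c).contMDiffAt ((isOpen_extChartAt_target c).mem_nhds hz)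

variable (E) in
/-- The derivative at `q` of the chart at `c`, as an endomorphism of the model space to which
every tangent space is definitionally equal. -/
def chartDeriv (c q : M) : E →L[ℝ] E := mfderiv 𝓘(ℝ, E) 𝓘(ℝ, E) (extChartAt 𝓘(ℝ, E) c) q

/-- The derivative at `z` of the inverse of the chart at `c`, as an endomorphism of the model
space. -/
def chartSymmDeriv (c : M) (z : E) : E →L[ℝ] E :=
  mfderiv 𝓘(ℝ, E) 𝓘(ℝ, E) (extChartAt 𝓘(ℝ, E) c).symm z

theorem chartDeriv_chartSymmDeriv {c : M} {z : E} (hz : z ∈ (extChartAt 𝓘(ℝ, E) c).target)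
    (v : E) : chartDeriv E c ((extChartAt 𝓘(ℝ, E) c).symm z) (chartSymmDeriv c z v) = v := by
  have := mfderiv_extChartAt_comp_mfderivWithin_extChartAt_symm (I := 𝓘(ℝ, E)) hz
  simp only [modelWithCornersSelf_coe, range_id, mfderivWithin_univ] at this
  exact congrArg (fun L => L v) this

theorem chartSymmDeriv_chartDeriv {c : M} {q : M} (hq : q ∈ (chartAt E c).source) (v : E) :
    chartSymmDeriv c (extChartAt 𝓘(ℝ, E) c q) (chartDeriv E c q v) = v := by
  obtain ⟨z, hz, rfl⟩ : ∃ z ∈ (extChartAt 𝓘(ℝ, E) c).target,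
      (extChartAt 𝓘(ℝ, E) c).symm z = q :=
    ⟨_, (extChartAt 𝓘(ℝ, E) c).map_source (by simpa using hq),
      (extChartAt 𝓘(ℝ, E) c).left_inv (by simpa using hq)⟩
  rw [(extChartAt 𝓘(ℝ, E) c).right_inv hz]
  have := mfderivWithin_extChartAt_symm_comp_mfderiv_extChartAt (I := 𝓘(ℝ, E)) hz
  simp only [modelWithCornersSelf_coe, range_id, mfderivWithin_univ] at this
  exact congrArg (fun L => L v) this

theorem chartDeriv_chartSymmDeriv' {c : M} {q : M} (hq : q ∈ (chartAt E c).source) (v : E) :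
    chartDeriv E c q (chartSymmDeriv c (extChartAt 𝓘(ℝ, E) c q) v) = v := by
  have := chartDeriv_chartSymmDeriv (c := c) (z := extChartAt 𝓘(ℝ, E) c q)
    ((extChartAt 𝓘(ℝ, E) c).map_source (by simpa using hq)) v
  rwa [(extChartAt 𝓘(ℝ, E) c).left_inv (by simpa using hq)] at this

theorem trivializationAt_snd {c q : M} (hq : q ∈ (chartAt E c).source)
    (v : TangentSpace 𝓘(ℝ, E) q) :
    (trivializationAt E (TangentSpace 𝓘(ℝ, E)) c (⟨q, v⟩ : TangentBundle 𝓘(ℝ, E) M)).2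
      = chartDeriv E c q v := by
  have h := TangentBundle.continuousLinearMapAt_trivializationAt (𝕜 := ℝ) (I := 𝓘(ℝ, E)) hq
  have h1 : (trivializationAt E (TangentSpace 𝓘(ℝ, E)) c).continuousLinearMapAt ℝ q v =
    chartDeriv E c q v := by rw [h]; rfl
  rw [← h1, Trivialization.continuousLinearMapAt_apply, Trivialization.linearMapAt_apply, if_pos]
  simpa using hq

/-- Smoothness of a map into the tangent bundle, read in a chart. -/
theorem contMDiffOn_tangentBundle_iff {X : Type*} [NormedAddCommGroup X] [NormedSpace ℝ X]
    {c : M} {s : Set X} {γ : X → M} {V : X → E} (hs : ∀ t ∈ s, γ t ∈ (chartAt E c).source) :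
    ContMDiffOn 𝓘(ℝ, X) 𝓘(ℝ, E).tangent ∞
        (fun t => (⟨γ t, V t⟩ : TangentBundle 𝓘(ℝ, E) M)) s ↔
      ContMDiffOn 𝓘(ℝ, X) 𝓘(ℝ, E) ∞ γ s ∧
        ContDiffOn ℝ ∞ (fun t => chartDeriv E c (γ t) (V t)) s := by
  rw [(trivializationAt E (TangentSpace 𝓘(ℝ, E)) c).contMDiffOn_iff]
  · refine and_congr Iff.rfl ?_
    rw [← contMDiffOn_iff_contDiffOn]
    exact contMDiffOn_congr fun t ht => trivializationAt_snd (hs t ht) (V t)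
  · intro t ht
    rw [Trivialization.mem_source]
    simpa using hs t ht

/-- The change of coordinates from the chart at `c` to the chart at `c'`. -/
def transition (c c' : M) : E → E := extChartAt 𝓘(ℝ, E) c' ∘ (extChartAt 𝓘(ℝ, E) c).symm

theorem contDiffAt_transition {c c' q : M} (hc : q ∈ (chartAt E c).source)
    (hc' : q ∈ (chartAt E c').source) :
    ContDiffAt ℝ ∞ (transition c c') (extChartAt 𝓘(ℝ, E) c q) := by
  have h1 := contMDiffAt_extChartAt_symm' (c := c) (z := extChartAt 𝓘(ℝ, E) c q)
    ((extChartAt 𝓘(ℝ, E) c).map_source (by simpa using hc))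
  have h2 : (extChartAt 𝓘(ℝ, E) c).symm (extChartAt 𝓘(ℝ, E) c q) = q :=
    (extChartAt 𝓘(ℝ, E) c).left_inv (by simpa using hc)
  have h3 : ContMDiffAt 𝓘(ℝ, E) 𝓘(ℝ, E) ∞ (extChartAt 𝓘(ℝ, E) c')
    ((extChartAt 𝓘(ℝ, E) c).symm (extChartAt 𝓘(ℝ, E) c q)) := by
    rw [h2]; exact contMDiffAt_extChartAt' hc'
  exact (h3.comp _ h1).contDiffAt

omit [IsManifold 𝓘(ℝ, E) ∞ M] in
theorem transition_extChartAt {c c' q : M} (hc : q ∈ (chartAt E c).source) :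
    transition c c' (extChartAt 𝓘(ℝ, E) c q) = extChartAt 𝓘(ℝ, E) c' q := by
  rw [transition, comp_apply, (extChartAt 𝓘(ℝ, E) c).left_inv (by simpa using hc)]

theorem chartDeriv_eq_transition {c c' q : M} (hc : q ∈ (chartAt E c).source)
    (hc' : q ∈ (chartAt E c').source) (v : E) :
    chartDeriv E c' q v =
      fderiv ℝ (transition c c') (extChartAt 𝓘(ℝ, E) c q) (chartDeriv E c q v) := by
  have h1 : extChartAt 𝓘(ℝ, E) c' =ᶠ[𝓝 q] transition c c' ∘ extChartAt 𝓘(ℝ, E) c := by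
    filter_upwards [(chartAt E c).open_source.mem_nhds hc] with r hr
    exact (transition_extChartAt hr).symm
  have h2 := ((contDiffAt_transition hc hc').differentiableAt (by simp)).mdifferentiableAt
  have h3 := mdifferentiableAt_extChartAt (I := 𝓘(ℝ, E)) hc
  rw [chartDeriv, h1.mfderiv_eq, mfderiv_comp q h2 h3, mfderiv_eq_fderiv]
  rfl

end Charts

/-! ### The metric and the Christoffel symbols in a chart -/

section Metric

variable {E : Type*} [NormedAddCommGroup E] [NormedSpace ℝ E]
  {M : Type*} [TopologicalSpace M] [ChartedSpace E M] [IsManifold 𝓘(ℝ, E) ∞ M]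
  [RiemannianBundle (fun q : M => TangentSpace 𝓘(ℝ, E) q)]

/-- The Riemannian inner product of two vectors of the model space, seen as tangent vectors
at `q`. -/
def tangentInner (q : M) (v w : E) : ℝ := inner ℝ (E := TangentSpace 𝓘(ℝ, E) q) v w

omit [IsManifold 𝓘(ℝ, E) ∞ M] in
theorem tangentInner_comm (q : M) (v w : E) : tangentInner q v w = tangentInner q w v :=
  real_inner_comm (F := TangentSpace 𝓘(ℝ, E) q) w v

omit [IsManifold 𝓘(ℝ, E) ∞ M] in
theorem tangentInner_self_pos (q : M) {v : E} (hv : v ≠ 0) : 0 < tangentInner q v v :=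
  real_inner_self_pos (F := TangentSpace 𝓘(ℝ, E) q).2 hv

omit [IsManifold 𝓘(ℝ, E) ∞ M] in
theorem chartMetric_apply (c : M) (z v w : E) :
    chartMetric c z v w = tangentInner ((extChartAt 𝓘(ℝ, E) c).symm z)
      (chartSymmDeriv c z v) (chartSymmDeriv c z w) := rfl

theorem chartMetric_extChartAt {c q : M} (hq : q ∈ (chartAt E c).source) (v w : E) :
    chartMetric c (extChartAt 𝓘(ℝ, E) c q) (chartDeriv E c q v) (chartDeriv E c q w)
      = tangentInner q v w := by
  rw [chartMetric_apply, chartSymmDeriv_chartDeriv hq, chartSymmDeriv_chartDeriv hq,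
    (extChartAt 𝓘(ℝ, E) c).left_inv (by simpa using hq)]

omit [IsManifold 𝓘(ℝ, E) ∞ M] in
theorem chartMetric_symm (c : M) (z v w : E) : chartMetric c z v w = chartMetric c z w v := by
  rw [chartMetric_apply, chartMetric_apply, tangentInner_comm]

theorem chartMetric_pos {c : M} {z : E} (hz : z ∈ (extChartAt 𝓘(ℝ, E) c).target) {v : E}
    (hv : v ≠ 0) : 0 < chartMetric c z v v := by
  rw [chartMetric_apply]
  refine tangentInner_self_pos _ fun h => hv ?_
  rw [← chartDeriv_chartSymmDeriv hz v, h, map_zero]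

theorem isInvertible_chartMetric [FiniteDimensional ℝ E] {c : M} {z : E}
    (hz : z ∈ (extChartAt 𝓘(ℝ, E) c).target) : (chartMetric c z).IsInvertible := by
  have hinj : Function.Injective (chartMetric c z) := by
    rw [injective_iff_map_eq_zero]
    intro v hv
    by_contra h
    exact (chartMetric_pos hz h).ne' (by rw [hv]; rfl)
  have hdim : Module.finrank ℝ E = Module.finrank ℝ (E →L[ℝ] ℝ) := by
    rw [← LinearMap.toContinuousLinearMap.finrank_eq, Subspace.dual_finrank_eq]
  exact ⟨(LinearEquiv.ofInjectiveOfFinrankEq (chartMetric c z : E →ₗ[ℝ] (E →L[ℝ] ℝ)) hinj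
    hdim).toContinuousLinearEquiv, by ext; rfl⟩

theorem contDiffOn_chartMetric [FiniteDimensional ℝ E]
    [IsContMDiffRiemannianBundle 𝓘(ℝ, E) ∞ E (fun q : M => TangentSpace 𝓘(ℝ, E) q)] (c : M) :
    ContDiffOn ℝ ∞ (chartMetric c) (extChartAt 𝓘(ℝ, E) c).target := by
  rw [contDiffOn_clm_apply]
  intro v
  rw [contDiffOn_clm_apply]
  intro w
  have key : ∀ v : E, ContMDiffOn 𝓘(ℝ, E) 𝓘(ℝ, E).tangent ∞
      (fun z => (⟨(extChartAt 𝓘(ℝ, E) c).symm z, chartSymmDeriv c z v⟩ :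
        TangentBundle 𝓘(ℝ, E) M)) (extChartAt 𝓘(ℝ, E) c).target := by
    intro v
    rw [contMDiffOn_tangentBundle_iff (c := c) fun z hz => by
      simpa using (extChartAt 𝓘(ℝ, E) c).map_target hz]
    exact ⟨contMDiffOn_extChartAt_symm c,
      contDiffOn_const.congr fun z hz => chartDeriv_chartSymmDeriv hz v⟩
  have := ContMDiffOn.inner_bundle (n := ∞) (IM := 𝓘(ℝ, E)) (IB := 𝓘(ℝ, E)) (F := E)
    (E := fun q : M => TangentSpace 𝓘(ℝ, E) q) (b := (extChartAt 𝓘(ℝ, E) c).symm)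
    (v := fun z => chartSymmDeriv c z v) (w := fun z => chartSymmDeriv c z w)
    (s := (extChartAt 𝓘(ℝ, E) c).target) (key v) (key w)
  exact this.contDiffOn

/-- The metric in one chart is the pullback, by the change of coordinates, of that in another. -/
theorem chartMetric_transition {c c' q : M} (hc : q ∈ (chartAt E c).source)
    (hc' : q ∈ (chartAt E c').source) (v w : E) :
    chartMetric c (extChartAt 𝓘(ℝ, E) c q) v w =
      chartMetric c' (transition c c' (extChartAt 𝓘(ℝ, E) c q))
        (fderiv ℝ (transition c c') (extChartAt 𝓘(ℝ, E) c q) v)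
        (fderiv ℝ (transition c c') (extChartAt 𝓘(ℝ, E) c q) w) := by
  have hs : ∀ v : E, ∃ v' : E, chartDeriv E c q v' = v := fun v =>
    ⟨_, chartDeriv_chartSymmDeriv' hc v⟩
  obtain ⟨v, rfl⟩ := hs v
  obtain ⟨w, rfl⟩ := hs w
  rw [chartMetric_extChartAt hc, transition_extChartAt hc, ← chartDeriv_eq_transition hc hc',
    ← chartDeriv_eq_transition hc hc', chartMetric_extChartAt hc']

section Christoffel

variable [FiniteDimensional ℝ E]
  [IsContMDiffRiemannianBundle 𝓘(ℝ, E) ∞ E (fun q : M => TangentSpace 𝓘(ℝ, E) q)]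

theorem differentiableAt_chartMetric {c : M} {z : E}
    (hz : z ∈ (extChartAt 𝓘(ℝ, E) c).target) : DifferentiableAt ℝ (chartMetric c) z :=
  ((contDiffOn_chartMetric c).contDiffAt
    ((isOpen_extChartAt_target c).mem_nhds hz)).differentiableAt (by simp)

omit [IsManifold 𝓘(ℝ, E) ∞ M] [FiniteDimensional ℝ E]
  [IsContMDiffRiemannianBundle 𝓘(ℝ, E) ∞ E (fun q : M => TangentSpace 𝓘(ℝ, E) q)] in
theorem christoffelFirst_apply (c : M) (z v w u : E) :
    christoffelFirst c z v w u = (1 / 2 : ℝ) * (fderiv ℝ (chartMetric c) z v w u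
      + fderiv ℝ (chartMetric c) z w v u - fderiv ℝ (chartMetric c) z u v w) := rfl

theorem fderiv_chartMetric_symm {c : M} {z : E} (hz : z ∈ (extChartAt 𝓘(ℝ, E) c).target)
    (a v w : E) : fderiv ℝ (chartMetric c) z a v w = fderiv ℝ (chartMetric c) z a w v := by
  have h (v w : E) := fderiv_form_apply (differentiableAt_chartMetric hz)
    (differentiableAt_const v) (differentiableAt_const w) a
  have e : (fun x => chartMetric c x v w) = fun x => chartMetric c x w v :=
    funext fun x => chartMetric_symm c x v w
  have h1 := h v w
  rw [e, h w v] at h1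
  simpa using h1.symm

omit [IsContMDiffRiemannianBundle 𝓘(ℝ, E) ∞ E (fun q : M => TangentSpace 𝓘(ℝ, E) q)] in
/-- The defining property of the Christoffel symbols. -/
theorem chartMetric_christoffel {c : M} {z : E} (hz : z ∈ (extChartAt 𝓘(ℝ, E) c).target)
    (v w u : E) : chartMetric c z (christoffel c z v w) u = christoffelFirst c z v w u := by
  obtain ⟨e, he⟩ := isInvertible_chartMetric hz
  rw [christoffel, ← he, ContinuousLinearMap.inverse_equiv]
  simp

/-- Compatibility of the Christoffel symbols with the metric. -/
theorem chartMetric_christoffel_add {c : M} {z : E} (hz : z ∈ (extChartAt 𝓘(ℝ, E) c).target)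
    (a v w : E) : chartMetric c z (christoffel c z a v) w + chartMetric c z v (christoffel c z a w)
      = fderiv ℝ (chartMetric c) z a v w := by
  rw [chartMetric_symm c z v, chartMetric_christoffel hz, chartMetric_christoffel hz,
    christoffelFirst_apply, christoffelFirst_apply, fderiv_chartMetric_symm hz a w v,
    fderiv_chartMetric_symm hz w a v, fderiv_chartMetric_symm hz v a w]
  rw [fderiv_chartMetric_symm hz w v a, fderiv_chartMetric_symm hz v w a]
  ring

/-- The transformation law of the Christoffel symbols under a change of chart. -/
theorem fderiv_transition_christoffel {c c' q : M} (hc : q ∈ (chartAt E c).source)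
    (hc' : q ∈ (chartAt E c').source) {z : E} (hz : extChartAt 𝓘(ℝ, E) c q = z) (v w : E) :
    fderiv ℝ (transition c c') z (christoffel c z v w)
      = christoffel c' (transition c c' z) (fderiv ℝ (transition c c') z v)
          (fderiv ℝ (transition c c') z w)
        + fderiv ℝ (fderiv ℝ (transition c c')) z v w := by
  subst hz
  set z := extChartAt 𝓘(ℝ, E) c q with hzdef
  set ψ := transition (E := E) c c' with hψdef
  have hψz : ψ z = extChartAt 𝓘(ℝ, E) c' q := transition_extChartAt hc
  have hzt : z ∈ (extChartAt 𝓘(ℝ, E) c).target :=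
    (extChartAt 𝓘(ℝ, E) c).map_source (by simpa using hc)
  have hzt' : ψ z ∈ (extChartAt 𝓘(ℝ, E) c').target := by
    rw [hψz]; exact (extChartAt 𝓘(ℝ, E) c').map_source (by simpa using hc')
  have hψ : ContDiffAt ℝ 2 ψ z := (contDiffAt_transition hc hc').of_le (by norm_cast)
  have hsymm : ∀ a b, fderiv ℝ (fderiv ℝ ψ) z a b = fderiv ℝ (fderiv ℝ ψ) z b a :=
    fun a b => (hψ.isSymmSndFDerivAt (by simp)).eq a b
  have hev : ∀ᶠ x in 𝓝 z, ∀ v w, chartMetric c x v w =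
      chartMetric c' (ψ x) (fderiv ℝ ψ x v) (fderiv ℝ ψ x w) := by
    have h1 : ∀ᶠ x in 𝓝 z, (extChartAt 𝓘(ℝ, E) c).symm x ∈ (chartAt E c').source := by
      refine (contMDiffAt_extChartAt_symm' hzt).continuousAt.eventually_mem ?_
      rw [hzdef, (extChartAt 𝓘(ℝ, E) c).left_inv (by simpa using hc)]
      exact (chartAt E c').open_source.mem_nhds hc'
    filter_upwards [h1, (isOpen_extChartAt_target c).mem_nhds hzt] with x hx hxt v w
    have := chartMetric_transition (E := E) (c := c) (c' := c')
      (by simpa using (extChartAt 𝓘(ℝ, E) c).map_target hxt) hx v w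
    rwa [(extChartAt 𝓘(ℝ, E) c).right_inv hxt] at this
  have hder := fderiv_pullback_form (differentiableAt_chartMetric hzt)
    (differentiableAt_chartMetric hzt') hψ hev
  -- the two sides have the same inner product with every vector `dψ u`, by the formula for the
  -- first Christoffel symbols and the symmetry of the second derivative of `ψ`
  have hfirst : ∀ u, chartMetric c' (ψ z) (fderiv ℝ ψ z (christoffel c z v w)
      - christoffel c' (ψ z) (fderiv ℝ ψ z v) (fderiv ℝ ψ z w)
      - fderiv ℝ (fderiv ℝ ψ) z v w) (fderiv ℝ ψ z u) = 0 := by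
    intro u
    have h1 := hev.self_of_nhds (christoffel c z v w) u
    rw [chartMetric_christoffel hzt, christoffelFirst_apply, hder, hder, hder] at h1
    have h2 := chartMetric_christoffel hzt' (fderiv ℝ ψ z v) (fderiv ℝ ψ z w) (fderiv ℝ ψ z u)
    rw [christoffelFirst_apply] at h2
    simp only [map_sub, sub_apply]
    rw [h2, ← h1, hsymm w v, hsymm u v, hsymm u w,
      chartMetric_symm c' _ (fderiv ℝ (fderiv ℝ ψ) z v u),
      chartMetric_symm c' _ (fderiv ℝ ψ z v) (fderiv ℝ (fderiv ℝ ψ) z w u)]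
    rw [chartMetric_symm c' _ (fderiv ℝ (fderiv ℝ ψ) z w u)]
    ring
  have hsurj : ∀ X : E, ∃ u, fderiv ℝ ψ z u = X := by
    intro X
    refine ⟨chartDeriv E c q (chartSymmDeriv c' (extChartAt 𝓘(ℝ, E) c' q) X), ?_⟩
    rw [← chartDeriv_eq_transition hc hc', chartDeriv_chartSymmDeriv' hc']
  have h0 : fderiv ℝ ψ z (christoffel c z v w)
      - christoffel c' (ψ z) (fderiv ℝ ψ z v) (fderiv ℝ ψ z w)
      - fderiv ℝ (fderiv ℝ ψ) z v w = 0 := by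
    by_contra hne
    obtain ⟨u, hu⟩ := hsurj _
    have := hfirst u
    rw [hu] at this
    exact (chartMetric_pos hzt' hne).ne' this
  rw [sub_sub, sub_eq_zero] at h0
  exact h0

end Christoffel

end Metric

/-! ### The system for planar curves -/

section System

variable {E : Type*} [NormedAddCommGroup E] [NormedSpace ℝ E]
  {M : Type*} [TopologicalSpace M] [ChartedSpace E M]

/-- The derivative of the image, under the map `ψ` and its derivative, of a curve of points with two
vectors. -/
theorem hasDerivAt_tangentLift {ψ : E → E} {z v w : ℝ → E} {z' v' w' : E} {t : ℝ}
    (hψ : ContDiffAt ℝ 2 ψ (z t)) (hz : HasDerivAt z z' t) (hv : HasDerivAt v v' t)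
    (hw : HasDerivAt w w' t) :
    HasDerivAt (fun s => (ψ (z s), fderiv ℝ ψ (z s) (v s), fderiv ℝ ψ (z s) (w s)))
      (fderiv ℝ ψ (z t) z',
        fderiv ℝ (fderiv ℝ ψ) (z t) z' (v t) + fderiv ℝ ψ (z t) v',
        fderiv ℝ (fderiv ℝ ψ) (z t) z' (w t) + fderiv ℝ ψ (z t) w') t := by
  have hψ1 : HasFDerivAt ψ (fderiv ℝ ψ (z t)) (z t) := (hψ.differentiableAt (by simp)).hasFDerivAt
  have hψ2 : HasFDerivAt (fderiv ℝ ψ) (fderiv ℝ (fderiv ℝ ψ) (z t)) (z t) :=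
    ((hψ.fderiv_right (m := 1) (by norm_num)).differentiableAt (by simp)).hasFDerivAt
  have h2 : HasDerivAt (fun s => fderiv ℝ ψ (z s)) (fderiv ℝ (fderiv ℝ ψ) (z t) z') t :=
    hψ2.comp_hasDerivAt t hz
  exact (hψ1.comp_hasDerivAt t hz).prodMk ((h2.clm_apply hv).prodMk (h2.clm_apply hw))

/-- The coordinates `(φ q, dφ v, dφ w)`, in the chart `φ` at `c`, of a point `q` together with two
tangent vectors `v`, `w` there. -/
def stateCoord (c : M) (s : M × E × E) : E × E × E :=
  (extChartAt 𝓘(ℝ, E) c s.1, chartDeriv E c s.1 s.2.1, chartDeriv E c s.1 s.2.2)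

/-- The point with two tangent vectors that has given coordinates in the chart at `c`. -/
def stateLift (c : M) (u : E × E × E) : M × E × E :=
  ((extChartAt 𝓘(ℝ, E) c).symm u.1, chartSymmDeriv c u.1 u.2.1, chartSymmDeriv c u.1 u.2.2)

/-- The change of the coordinates `stateCoord` from the chart at `c` to the chart at `c'`. -/
def stateChange (c c' : M) (u : E × E × E) : E × E × E :=
  (transition c c' u.1, fderiv ℝ (transition c c') u.1 u.2.1, fderiv ℝ (transition c c') u.1 u.2.2)

/-- The coordinates that lie in the target of the chart at `c`. -/
def stateDomain (c : M) : Set (E × E × E) := {u | u.1 ∈ (extChartAt 𝓘(ℝ, E) c).target}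

theorem isOpen_stateDomain (c : M) : IsOpen (stateDomain (E := E) c) :=
  (isOpen_extChartAt_target c).preimage continuous_fst

theorem stateCoord_mem_stateDomain {c : M} {s : M × E × E} (hs : s.1 ∈ (chartAt E c).source) :
    stateCoord c s ∈ stateDomain c :=
  (extChartAt 𝓘(ℝ, E) c).map_source (by simpa using hs)

theorem stateLift_mem_source {c : M} {u : E × E × E} (hu : u ∈ stateDomain c) :
    (stateLift c u).1 ∈ (chartAt E c).source := by
  simpa using! (extChartAt 𝓘(ℝ, E) c).map_target hu

variable [IsManifold 𝓘(ℝ, E) ∞ M]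

theorem stateCoord_stateLift {c : M} {u : E × E × E} (hu : u ∈ stateDomain c) :
    stateCoord c (stateLift c u) = u := by
  simp only [stateCoord, stateLift]
  rw [(extChartAt 𝓘(ℝ, E) c).right_inv hu, chartDeriv_chartSymmDeriv hu,
    chartDeriv_chartSymmDeriv hu]

theorem stateLift_stateCoord {c : M} {s : M × E × E} (hs : s.1 ∈ (chartAt E c).source) :
    stateLift c (stateCoord c s) = s := by
  simp only [stateCoord, stateLift]
  rw [(extChartAt 𝓘(ℝ, E) c).left_inv (by simpa using hs), chartSymmDeriv_chartDeriv hs,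
    chartSymmDeriv_chartDeriv hs]

theorem stateCoord_injOn {c : M} {s s' : M × E × E} (hs : s.1 ∈ (chartAt E c).source)
    (hs' : s'.1 ∈ (chartAt E c).source) (h : stateCoord c s = stateCoord c s') : s = s' := by
  rw [← stateLift_stateCoord hs, h, stateLift_stateCoord hs']

theorem stateChange_stateCoord {c c' : M} {s : M × E × E} (hc : s.1 ∈ (chartAt E c).source)
    (hc' : s.1 ∈ (chartAt E c').source) : stateChange c c' (stateCoord c s) = stateCoord c' s := by
  simp only [stateCoord, stateChange]
  rw [transition_extChartAt hc, ← chartDeriv_eq_transition hc hc',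
    ← chartDeriv_eq_transition hc hc']

variable [RiemannianBundle (fun q : M => TangentSpace 𝓘(ℝ, E) q)]

/-- The equations `∇_T T = κ Y`, `∇_T Y = -κ T` as a first-order system for the coordinates
`(z, v, w)` of `(γ, T, Y)` in the chart at `c`. -/
def frenetField (κ : ℝ → ℝ) (c : M) (t : ℝ) (u : E × E × E) : E × E × E :=
  (u.2.1, κ t • u.2.2 - christoffel c u.1 u.2.1 u.2.1,
    -κ t • u.2.1 - christoffel c u.1 u.2.1 u.2.2)

/-- `σ = (γ, T, Y)` solves the system for planar curves on `J`, in every chart. -/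
structure IsFrenetOn (κ : ℝ → ℝ) (σ : ℝ → M × E × E) (J : Set ℝ) : Prop where
  continuousAt : ∀ t ∈ J, ContinuousAt (fun s => (σ s).1) t
  hasDerivAt : ∀ t ∈ J, ∀ c : M, (σ t).1 ∈ (chartAt E c).source →
    HasDerivAt (stateCoord c ∘ σ) (frenetField κ c t (stateCoord c (σ t))) t

section Basic

variable {κ : ℝ → ℝ} {σ : ℝ → M × E × E} {J : Set ℝ}

omit [IsManifold 𝓘(ℝ, E) ∞ M]

theorem IsFrenetOn.mono {J' : Set ℝ} (h : IsFrenetOn κ σ J) (hJ : J' ⊆ J) : IsFrenetOn κ σ J' :=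
  ⟨fun t ht => h.continuousAt t (hJ ht), fun t ht => h.hasDerivAt t (hJ ht)⟩

theorem IsFrenetOn.congr {σ' : ℝ → M × E × E} (h : IsFrenetOn κ σ J) (hJ : IsOpen J)
    (he : EqOn σ' σ J) : IsFrenetOn κ σ' J := by
  have hev : ∀ t ∈ J, σ' =ᶠ[𝓝 t] σ := fun t ht => he.eventuallyEq_of_mem (hJ.mem_nhds ht)
  refine ⟨fun t ht => (h.continuousAt t ht).congr ((hev t ht).symm.fun_comp Prod.fst),
    fun t ht c hc => ?_⟩
  rw [he ht] at hc ⊢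
  exact (h.hasDerivAt t ht c hc).congr_of_eventuallyEq ((hev t ht).fun_comp (stateCoord c))

theorem IsFrenetOn.eventually_mem_source (h : IsFrenetOn κ σ J) {t : ℝ} (ht : t ∈ J) {c : M}
    (hc : (σ t).1 ∈ (chartAt E c).source) : ∀ᶠ s in 𝓝 t, (σ s).1 ∈ (chartAt E c).source :=
  (h.continuousAt t ht).eventually_mem ((chartAt E c).open_source.mem_nhds hc)

theorem IsFrenetOn.eventually_hasDerivAt (h : IsFrenetOn κ σ J) (hJ : IsOpen J) {t : ℝ}
    (ht : t ∈ J) {c : M} (hc : (σ t).1 ∈ (chartAt E c).source) :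
    ∀ᶠ s in 𝓝 t, HasDerivAt (stateCoord c ∘ σ) (frenetField κ c s ((stateCoord c ∘ σ) s)) s := by
  filter_upwards [h.eventually_mem_source ht hc, hJ.mem_nhds ht] with s hs hsJ
  exact h.hasDerivAt s hsJ c hs

end Basic

variable [FiniteDimensional ℝ E]
  [IsContMDiffRiemannianBundle 𝓘(ℝ, E) ∞ E (fun q : M => TangentSpace 𝓘(ℝ, E) q)]

theorem contDiffOn_christoffel (c : M) :
    ContDiffOn ℝ ∞ (fun u : E × E × E => christoffel c u.1 u.2.1 u.2.2) (stateDomain c) := by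
  have hfst : MapsTo (Prod.fst : E × E × E → E) (stateDomain c) (extChartAt 𝓘(ℝ, E) c).target :=
    fun u hu => hu
  have hg : ContDiffOn ℝ ∞ (fun u : E × E × E => chartMetric c u.1) (stateDomain c) :=
    (contDiffOn_chartMetric c).comp contDiffOn_fst hfst
  have hdg : ContDiffOn ℝ ∞ (fun u : E × E × E => fderiv ℝ (chartMetric c) u.1)
      (stateDomain c) :=
    ((contDiffOn_chartMetric c).fderiv_of_isOpen (isOpen_extChartAt_target c)
      (by simp)).comp contDiffOn_fst hfst
  have hv : ContDiffOn ℝ ∞ (fun u : E × E × E => u.2.1) (stateDomain c) := by fun_prop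
  have hw : ContDiffOn ℝ ∞ (fun u : E × E × E => u.2.2) (stateDomain c) := by fun_prop
  have hfirst : ContDiffOn ℝ ∞
      (fun u : E × E × E => christoffelFirst c u.1 u.2.1 u.2.2) (stateDomain c) := by
    rw [contDiffOn_clm_apply]
    intro y
    simp only [christoffelFirst_apply]
    have hy : ContDiffOn ℝ ∞ (fun _ : E × E × E => y) (stateDomain c) := contDiffOn_const
    exact contDiffOn_const.mul ((((hdg.clm_apply hv).clm_apply hw).clm_apply hy).add
      (((hdg.clm_apply hw).clm_apply hv).clm_apply hy) |>.sub
      (((hdg.clm_apply hy).clm_apply hv).clm_apply hw))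
  have hinv : ContDiffOn ℝ ∞ (fun u : E × E × E => (chartMetric c u.1).inverse)
      (stateDomain c) := by
    intro u hu
    obtain ⟨e, he⟩ := isInvertible_chartMetric (c := c) (z := u.1) hu
    have h1 : ContDiffAt ℝ ∞ ContinuousLinearMap.inverse (chartMetric c u.1) := by
      rw [← he]; exact contDiffAt_map_inverse e
    exact h1.comp_contDiffWithinAt u (hg u hu)
  exact hinv.clm_apply hfirst

theorem contDiffOn_frenetField {κ : ℝ → ℝ} (hκ : ContDiff ℝ ∞ κ) (c : M) :
    ContDiffOn ℝ ∞ (uncurry (frenetField (E := E) κ c)) (univ ×ˢ stateDomain (E := E) c) := by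
  have hκ' : ContDiffOn ℝ ∞ (fun q : ℝ × E × E × E => κ q.1)
      (univ ×ˢ stateDomain (E := E) c) :=
    (hκ.comp contDiff_fst).contDiffOn
  have h (a b : E × E × E → E) (ha : ContDiff ℝ ∞ a) (hb : ContDiff ℝ ∞ b) :
      ContDiffOn ℝ ∞ (fun q : ℝ × E × E × E => christoffel (M := M) c q.2.1 (a q.2) (b q.2))
        (univ ×ˢ stateDomain c) :=
    (contDiffOn_christoffel c).comp
      (g := fun u : E × E × E => christoffel (M := M) c u.1 u.2.1 u.2.2)
      (f := fun q : ℝ × E × E × E => (q.2.1, a q.2, b q.2))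
      (ContDiff.contDiffOn (by fun_prop)) fun q hq => hq.2
  refine ContDiffOn.prodMk (by fun_prop) (ContDiffOn.prodMk ?_ ?_)
  · exact (hκ'.smul (by fun_prop)).sub
      (h (fun u => u.2.1) (fun u => u.2.1) (by fun_prop) (by fun_prop))
  · exact (hκ'.neg.smul (by fun_prop)).sub
      (h (fun u => u.2.1) (fun u => u.2.2) (by fun_prop) (by fun_prop))

/-- The system for planar curves does not depend on the chart. -/
theorem hasDerivAt_stateCoord_change {κ : ℝ → ℝ} {σ : ℝ → M × E × E} {t : ℝ} {c c' : M}
    (hcont : ContinuousAt (fun s => (σ s).1) t)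
    (hc : (σ t).1 ∈ (chartAt E c).source)
    (hc' : (σ t).1 ∈ (chartAt E c').source)
    (h : HasDerivAt (stateCoord c ∘ σ) (frenetField κ c t (stateCoord c (σ t))) t) :
    HasDerivAt (stateCoord c' ∘ σ) (frenetField κ c' t (stateCoord c' (σ t))) t := by
  have hev : stateCoord c' ∘ σ =ᶠ[𝓝 t] stateChange c c' ∘ (stateCoord c ∘ σ) := by
    filter_upwards [hcont.eventually_mem ((chartAt E c).open_source.mem_nhds hc),
      hcont.eventually_mem ((chartAt E c').open_source.mem_nhds hc')] with s hs hs'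
    exact (stateChange_stateCoord hs hs').symm
  refine HasDerivAt.congr_of_eventuallyEq ?_ hev
  have hψ : ContDiffAt ℝ 2 (transition (E := E) c c') (stateCoord c (σ t)).1 :=
    (contDiffAt_transition hc hc').of_le (by norm_cast)
  have hz : HasDerivAt (fun s => (stateCoord c (σ s)).1)
    (frenetField κ c t (stateCoord c (σ t))).1 t := h.fst
  have hv : HasDerivAt (fun s => (stateCoord c (σ s)).2.1)
    (frenetField κ c t (stateCoord c (σ t))).2.1 t := h.snd.fst
  have hw : HasDerivAt (fun s => (stateCoord c (σ s)).2.2)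
    (frenetField κ c t (stateCoord c (σ t))).2.2 t := h.snd.snd
  refine (hasDerivAt_tangentLift hψ hz hv hw).congr_deriv ?_
  rw [← stateChange_stateCoord hc hc']
  have hΓ := fderiv_transition_christoffel hc hc' (z := (stateCoord c (σ t)).1) rfl
  simp only [stateChange, frenetField, map_sub, map_smul, hΓ]
  refine Prod.ext rfl (Prod.ext ?_ ?_)
  · simp only; abel
  · simp only; abel

end System

/-! ### Uniqueness, local existence and orthonormality -/

section Local

variable {E : Type*} [NormedAddCommGroup E] [NormedSpace ℝ E] [FiniteDimensional ℝ E]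
  {M : Type*} [TopologicalSpace M] [ChartedSpace E M] [IsManifold 𝓘(ℝ, E) ∞ M]
  [RiemannianBundle (fun q : M => TangentSpace 𝓘(ℝ, E) q)]
  [IsContMDiffRiemannianBundle 𝓘(ℝ, E) ∞ E (fun q : M => TangentSpace 𝓘(ℝ, E) q)]

theorem IsFrenetOn.eventuallyEq {κ : ℝ → ℝ} (hκ : ContDiff ℝ ∞ κ) {σ₁ σ₂ : ℝ → M × E × E}
    {J : Set ℝ} (hJ : IsOpen J) (h₁ : IsFrenetOn κ σ₁ J) (h₂ : IsFrenetOn κ σ₂ J) {t : ℝ}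
    (ht : t ∈ J) (h : σ₁ t = σ₂ t) : σ₁ =ᶠ[𝓝 t] σ₂ := by
  set c := (σ₁ t).1 with hcdef
  have hc₁ : (σ₁ t).1 ∈ (chartAt E c).source := mem_chart_source E c
  have hc₂ : (σ₂ t).1 ∈ (chartAt E c).source := h ▸ hc₁
  have hF : ContDiffAt ℝ 1 (uncurry (frenetField (E := E) κ c)) (t, (stateCoord c ∘ σ₁) t) :=
    ((contDiffOn_frenetField hκ c).contDiffAt ((isOpen_univ.prod (isOpen_stateDomain c)).mem_nhds
      ⟨mem_univ _, stateCoord_mem_stateDomain hc₁⟩)).of_le (by norm_cast)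
  have := ode_unique_eventually hF (h₁.eventually_hasDerivAt hJ ht hc₁)
    (h₂.eventually_hasDerivAt hJ ht hc₂) (congrArg (stateCoord c) h)
  filter_upwards [this, h₁.eventually_mem_source ht hc₁, h₂.eventually_mem_source ht hc₂]
    with s hs hs₁ hs₂
  exact stateCoord_injOn hs₁ hs₂ hs

/-- Two solutions of the system on an interval that agree at one time agree throughout. -/
theorem IsFrenetOn.eqOn [T2Space M] {κ : ℝ → ℝ} (hκ : ContDiff ℝ ∞ κ) {σ₁ σ₂ : ℝ → M × E × E}
    {J : Set ℝ} (hJ : IsOpen J) (hJ' : IsPreconnected J) (h₁ : IsFrenetOn κ σ₁ J)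
    (h₂ : IsFrenetOn κ σ₂ J) {t₀ : ℝ} (ht₀ : t₀ ∈ J) (h : σ₁ t₀ = σ₂ t₀) : EqOn σ₁ σ₂ J := by
  suffices J ⊆ {t | σ₁ =ᶠ[𝓝 t] σ₂} from fun t ht => (this ht).self_of_nhds
  refine hJ'.subset_of_closure_inter_subset isOpen_setOfPred_eventually_nhds
    ⟨t₀, ht₀, h₁.eventuallyEq hκ hJ h₂ ht₀ h⟩ ?_
  rintro t ⟨htc, ht⟩
  have hfreq : ∃ᶠ s in 𝓝 t, σ₁ s = σ₂ s :=
    (mem_closure_iff_frequently.1 htc).mono fun s hs => hs.self_of_nhds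
  refine h₁.eventuallyEq hκ hJ h₂ ht ?_
  have hbase : (σ₁ t).1 = (σ₂ t).1 :=
    tendsto_nhds_unique_of_frequently_eq (h₁.continuousAt t ht) (h₂.continuousAt t ht)
      (hfreq.mono fun s hs => congrArg Prod.fst hs)
  set c := (σ₁ t).1 with hcdef
  have hc₁ : (σ₁ t).1 ∈ (chartAt E c).source := mem_chart_source E c
  have hc₂ : (σ₂ t).1 ∈ (chartAt E c).source := hbase ▸ hc₁
  refine stateCoord_injOn hc₁ hc₂ ?_
  exact tendsto_nhds_unique_of_frequently_eq (h₁.hasDerivAt t ht c hc₁).continuousAt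
    (h₂.hasDerivAt t ht c hc₂).continuousAt (hfreq.mono fun s hs => congrArg (stateCoord c) hs)

/-- Solutions of the system in one chart are solutions in the sense of `IsFrenetOn`. -/
theorem isFrenetOn_stateLift {κ : ℝ → ℝ} {c : M} {α : ℝ → E × E × E} {J : Set ℝ} (hJ : IsOpen J)
    (h : ∀ t ∈ J, α t ∈ stateDomain c ∧ HasDerivAt α (frenetField κ c t (α t)) t) :
    IsFrenetOn κ (stateLift c ∘ α) J := by
  have hcont : ∀ t ∈ J, ContinuousAt (fun s => ((stateLift c ∘ α) s).1) t := fun t ht =>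
    (contMDiffAt_extChartAt_symm' (h t ht).1).continuousAt.comp
      (f := fun s => (α s).1) (h t ht).2.continuousAt.fst
  refine ⟨hcont, fun t ht c' hc' => ?_⟩
  refine hasDerivAt_stateCoord_change (hcont t ht) (stateLift_mem_source (h t ht).1) hc' ?_
  rw [comp_apply, stateCoord_stateLift (h t ht).1]
  refine (h t ht).2.congr_of_eventuallyEq ?_
  filter_upwards [hJ.mem_nhds ht] with s hs
  exact stateCoord_stateLift (h s hs).1

omit [FiniteDimensional ℝ E] [IsManifold 𝓘(ℝ, E) ∞ M]
  [IsContMDiffRiemannianBundle 𝓘(ℝ, E) ∞ E (fun q : M => TangentSpace 𝓘(ℝ, E) q)] in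
theorem tangentInner_self_eq_one_iff {q : M} {v : TangentSpace 𝓘(ℝ, E) q} :
    tangentInner (E := E) q v v = 1 ↔ ‖v‖ = 1 := by
  have h : tangentInner (E := E) q v v = ‖v‖ ^ 2 := real_inner_self_eq_norm_sq v
  rw [h, pow_eq_one_iff_of_nonneg (norm_nonneg v) two_ne_zero]

omit [FiniteDimensional ℝ E] in
/-- Near a point, the coordinates of unit tangent vectors are bounded. -/
theorem eventually_norm_chartDeriv_le (q : M) :
    ∃ R : ℝ, ∀ᶠ r in 𝓝 q, ∀ v : E, tangentInner r v v = 1 → ‖chartDeriv E q r v‖ ≤ R := by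
  have : IsContinuousRiemannianBundle E (fun q : M => TangentSpace 𝓘(ℝ, E) q) := by
    obtain ⟨g, hg, hg'⟩ := ‹IsContMDiffRiemannianBundle 𝓘(ℝ, E) ∞ E
      (fun q : M => TangentSpace 𝓘(ℝ, E) q)›.exists_contMDiff
    exact ⟨g, hg.continuous, hg'⟩
  obtain ⟨C, hC, h⟩ := eventually_norm_trivializationAt_lt E
    (fun r : M => TangentSpace 𝓘(ℝ, E) r) q
  refine ⟨C, ?_⟩
  filter_upwards [h, (chartAt E q).open_source.mem_nhds (mem_chart_source E q)] with r hr hrs v hv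
  have h1 := TangentBundle.continuousLinearMapAt_trivializationAt (𝕜 := ℝ) (I := 𝓘(ℝ, E)) hrs
  have h2 : (trivializationAt E (TangentSpace 𝓘(ℝ, E)) q).continuousLinearMapAt ℝ r v =
    chartDeriv E q r v := by rw [h1]; rfl
  have h3 (w : TangentSpace 𝓘(ℝ, E) r) (hw : ‖w‖ = 1) :
      ‖(trivializationAt E (TangentSpace 𝓘(ℝ, E)) q).continuousLinearMapAt ℝ r w‖ ≤ C := by
    simpa [hw] using ContinuousLinearMap.le_of_opNorm_le _ hr.le w
  rw [← h2]
  exact h3 v (tangentInner_self_eq_one_iff.1 hv)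

/-- Near a given point and time, solutions with unit initial vectors have a common lifespan. -/
theorem exists_isFrenetOn_uniform {κ : ℝ → ℝ} (hκ : ContDiff ℝ ∞ κ) (q : M) (b : ℝ) :
    ∃ ε > 0, ∃ U ∈ 𝓝 q, ∀ t₀ ∈ closedBall b 1, ∀ s : M × E × E, s.1 ∈ U →
      tangentInner s.1 s.2.1 s.2.1 = 1 → tangentInner s.1 s.2.2 s.2.2 = 1 →
      ∃ σ : ℝ → M × E × E, IsFrenetOn κ σ (Ioo (t₀ - ε) (t₀ + ε)) ∧ σ t₀ = s := by
  obtain ⟨R, hR⟩ := eventually_norm_chartDeriv_le (E := E) q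
  obtain ⟨r, hr, hrt⟩ := nhds_basis_closedBall.mem_iff.1
    (extChartAt_target_mem_nhds (I := 𝓘(ℝ, E)) q)
  set S : Set (ℝ × E × E × E) := closedBall b 1 ×ˢ closedBall (extChartAt 𝓘(ℝ, E) q q) r ×ˢ
    closedBall 0 R ×ˢ closedBall 0 R with hS
  have hSc : IsCompact S := (isCompact_closedBall _ _).prod ((isCompact_closedBall _ _).prod
    ((isCompact_closedBall _ _).prod (isCompact_closedBall _ _)))
  obtain ⟨ε, hε, h⟩ := ode_exists_uniform (isOpen_stateDomain (E := E) q)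
    ((contDiffOn_frenetField hκ q).of_le (by norm_cast)) hSc fun u hu => hrt hu.2.1
  refine ⟨ε, hε, _, inter_mem (inter_mem hR ((chartAt E q).open_source.mem_nhds
    (mem_chart_source E q))) ((continuousAt_extChartAt (I := 𝓘(ℝ, E)) q).preimage_mem_nhds
      (closedBall_mem_nhds _ hr)), fun t₀ ht₀ s hs hv hw => ?_⟩
  obtain ⟨α, hα, hα'⟩ := h (t₀, stateCoord q s) ⟨ht₀, hs.2,
    mem_closedBall_zero_iff.2 (hs.1.1 _ hv), mem_closedBall_zero_iff.2 (hs.1.1 _ hw)⟩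
  refine ⟨stateLift q ∘ α, isFrenetOn_stateLift isOpen_Ioo hα', ?_⟩
  simp only at hα
  rw [comp_apply, hα, stateLift_stateCoord hs.1.2]

/-- Metric compatibility along a curve `z` in a chart, for arbitrary fields `v`, `w` along it. -/
theorem hasDerivAt_chartMetric {c : M} {z v w : ℝ → E} {z' v' w' : E} {t : ℝ}
    (h : z t ∈ (extChartAt 𝓘(ℝ, E) c).target) (hz : HasDerivAt z z' t) (hv : HasDerivAt v v' t)
    (hw : HasDerivAt w w' t) :
    HasDerivAt (fun s => chartMetric c (z s) (v s) (w s))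
      (chartMetric c (z t) (v' + christoffel c (z t) z' (v t)) (w t)
        + chartMetric c (z t) (v t) (w' + christoffel c (z t) z' (w t))) t := by
  have hg : HasDerivAt (fun s => chartMetric c (z s)) (fderiv ℝ (chartMetric c) (z t) z') t :=
    (differentiableAt_chartMetric h).hasFDerivAt.comp_hasDerivAt t hz
  refine ((hg.clm_apply hv).clm_apply hw).congr_deriv ?_
  rw [← add_right_inj (-(fderiv ℝ (chartMetric c) (z t) z' (v t) (w t)))]
  nth_rw 2 [← chartMetric_christoffel_add h]
  simp only [map_add, add_apply]
  ring

/-- The derivative of the inner product of two fields along the curve, in terms of their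
covariant derivatives `A` and `B`. -/
theorem hasDerivAt_tangentInner {γ : ℝ → M} {V W : ℝ → E} {c : M} {t : ℝ} {z' v' w' A B : E}
    (hcont : ContinuousAt γ t) (hc : γ t ∈ (chartAt E c).source)
    (hz : HasDerivAt (fun s => extChartAt 𝓘(ℝ, E) c (γ s)) z' t)
    (hv : HasDerivAt (fun s => chartDeriv E c (γ s) (V s)) v' t)
    (hw : HasDerivAt (fun s => chartDeriv E c (γ s) (W s)) w' t)
    (hA : v' + christoffel c (extChartAt 𝓘(ℝ, E) c (γ t)) z' (chartDeriv E c (γ t) (V t))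
      = chartDeriv E c (γ t) A)
    (hB : w' + christoffel c (extChartAt 𝓘(ℝ, E) c (γ t)) z' (chartDeriv E c (γ t) (W t))
      = chartDeriv E c (γ t) B) :
    HasDerivAt (fun s => tangentInner (γ s) (V s) (W s))
      (tangentInner (γ t) A (W t) + tangentInner (γ t) (V t) B) t := by
  have h := hasDerivAt_chartMetric (c := c)
    ((extChartAt 𝓘(ℝ, E) c).map_source (by simpa using hc)) hz hv hw
  rw [hA, hB, chartMetric_extChartAt hc, chartMetric_extChartAt hc] at h
  refine h.congr_of_eventuallyEq ?_
  filter_upwards [hcont.eventually_mem ((chartAt E c).open_source.mem_nhds hc)] with s hs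
  exact (chartMetric_extChartAt hs _ _).symm

section Inner

variable {κ : ℝ → ℝ} {σ : ℝ → M × E × E} {J : Set ℝ}

theorem IsFrenetOn.hasDerivAt_inner (h : IsFrenetOn κ σ J) {t : ℝ} (ht : t ∈ J) :
    HasDerivAt (fun s => tangentInner (σ s).1 (σ s).2.1 (σ s).2.1)
      (2 * κ t * tangentInner (σ t).1 (σ t).2.1 (σ t).2.2) t ∧
    HasDerivAt (fun s => tangentInner (σ s).1 (σ s).2.2 (σ s).2.2)
      (-(2 * κ t * tangentInner (σ t).1 (σ t).2.1 (σ t).2.2)) t ∧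
    HasDerivAt (fun s => tangentInner (σ s).1 (σ s).2.1 (σ s).2.2)
      (κ t * (tangentInner (σ t).1 (σ t).2.2 (σ t).2.2
        - tangentInner (σ t).1 (σ t).2.1 (σ t).2.1)) t := by
  set c := (σ t).1 with hc
  have hd := h.hasDerivAt t ht c (mem_chart_source E c)
  have hsmul (a : ℝ) (v w : E) : tangentInner (σ t).1 (a • v) w = a * tangentInner (σ t).1 v w :=
    real_inner_smul_left (F := TangentSpace 𝓘(ℝ, E) (σ t).1) v w a
  have hsmul' (a : ℝ) (v w : E) : tangentInner (σ t).1 v (a • w) = a * tangentInner (σ t).1 v w :=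
    real_inner_smul_right (F := TangentSpace 𝓘(ℝ, E) (σ t).1) v w a
  have hcomm := tangentInner_comm (σ t).1 (σ t).2.2 (σ t).2.1
  have hv : (frenetField κ c t (stateCoord c (σ t))).2.1 + christoffel c
      (extChartAt 𝓘(ℝ, E) c (σ t).1) (frenetField κ c t (stateCoord c (σ t))).1
      (chartDeriv E c (σ t).1 (σ t).2.1) = chartDeriv E c (σ t).1 (κ t • (σ t).2.2) := by
    rw [map_smul]; exact sub_add_cancel _ _
  have hw : (frenetField κ c t (stateCoord c (σ t))).2.2 + christoffel c
      (extChartAt 𝓘(ℝ, E) c (σ t).1) (frenetField κ c t (stateCoord c (σ t))).1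
      (chartDeriv E c (σ t).1 (σ t).2.2) = chartDeriv E c (σ t).1 (-κ t • (σ t).2.1) := by
    rw [map_smul]; exact sub_add_cancel _ _
  have hz' := hd.fst
  have hv' := hd.snd.fst
  have hw' := hd.snd.snd
  have hcs := mem_chart_source E c
  refine ⟨?_, ?_, ?_⟩
  · refine (hasDerivAt_tangentInner (h.continuousAt t ht) hcs hz' hv' hv' hv hv).congr_deriv ?_
    rw [hsmul, hsmul', hcomm]; ring
  · refine (hasDerivAt_tangentInner (h.continuousAt t ht) hcs hz' hw' hw' hw hw).congr_deriv ?_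
    rw [hsmul, hsmul', hcomm]; ring
  · refine (hasDerivAt_tangentInner (h.continuousAt t ht) hcs hz' hv' hw' hv hw).congr_deriv ?_
    rw [hsmul, hsmul']; ring

/-- Along a solution that is an orthonormal pair at one time, `T` and `Y` are unit vectors. -/
theorem IsFrenetOn.tangentInner_self_eq_one (h : IsFrenetOn κ σ J) (hJ : IsOpen J)
    (hJ' : IsPreconnected J) {t₀ : ℝ} (ht₀ : t₀ ∈ J)
    (h₁ : tangentInner (σ t₀).1 (σ t₀).2.1 (σ t₀).2.1 = 1)
    (h₂ : tangentInner (σ t₀).1 (σ t₀).2.2 (σ t₀).2.2 = 1)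
    (h₃ : tangentInner (σ t₀).1 (σ t₀).2.1 (σ t₀).2.2 = 0) {t : ℝ} (ht : t ∈ J) :
    tangentInner (σ t).1 (σ t).2.1 (σ t).2.1 = 1 ∧
      tangentInner (σ t).1 (σ t).2.2 (σ t).2.2 = 1 := by
  -- with `P = ⟨T, T⟩`, `Q = ⟨Y, Y⟩`, `R = ⟨T, Y⟩`, the equations `P' = 2κR`, `Q' = -2κR`,
  -- `R' = κ(Q - P)` make `(P - 1)² + (Q - 1)² + 2R²` constant
  let F : ℝ → ℝ := fun s => (tangentInner (σ s).1 (σ s).2.1 (σ s).2.1 - 1) ^ 2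
    + (tangentInner (σ s).1 (σ s).2.2 (σ s).2.2 - 1) ^ 2
    + 2 * tangentInner (σ s).1 (σ s).2.1 (σ s).2.2 ^ 2
  have hF : ∀ s ∈ J, HasDerivAt F 0 s := by
    intro s hs
    obtain ⟨hP, hQ, hR⟩ := h.hasDerivAt_inner hs
    refine ((((hP.sub_const 1).pow 2).add ((hQ.sub_const 1).pow 2)).add
      ((hR.pow 2).const_mul 2)).congr_deriv ?_
    simp
    ring
  have hFt : F t = F t₀ := hJ.is_const_of_deriv_eq_zero hJ'
    (fun s hs => (hF s hs).differentiableAt.differentiableWithinAt)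
    (fun s hs => (hF s hs).deriv) ht ht₀
  have h0 : F t = 0 := by rw [hFt]; simp [F, h₁, h₂, h₃]
  simp only [F] at h0
  constructor <;> nlinarith [sq_nonneg (tangentInner (σ t).1 (σ t).2.1 (σ t).2.1 - 1),
    sq_nonneg (tangentInner (σ t).1 (σ t).2.2 (σ t).2.2 - 1),
    sq_nonneg (tangentInner (σ t).1 (σ t).2.1 (σ t).2.2)]

end Inner

end Local

/-! ### Planar curves as solutions of the system -/

section Planar

variable {E : Type*} [NormedAddCommGroup E] [NormedSpace ℝ E] [FiniteDimensional ℝ E]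
  {M : Type*} [TopologicalSpace M] [ChartedSpace E M] [IsManifold 𝓘(ℝ, E) ∞ M]

variable (E) in
/-- The tangent vector field of a curve, with values in the model space. -/
def modelVelocity (γ : ℝ → M) (t : ℝ) : E := velocity E γ t

omit [FiniteDimensional ℝ E] in
theorem hasDerivAt_extChartAt_comp {γ : ℝ → M} {t : ℝ} {c : M}
    (hγ : MDifferentiableAt 𝓘(ℝ, ℝ) 𝓘(ℝ, E) γ t) (hc : γ t ∈ (chartAt E c).source) :
    HasDerivAt (fun s => extChartAt 𝓘(ℝ, E) c (γ s)) (chartDeriv E c (γ t) (modelVelocity E γ t))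
      t := by
  have h := (mdifferentiableAt_extChartAt (I := 𝓘(ℝ, E)) hc).hasMFDerivAt.comp t hγ.hasMFDerivAt
  let A : ℝ →L[ℝ] E := mfderiv 𝓘(ℝ, ℝ) 𝓘(ℝ, E) γ t
  have h' : HasFDerivAt (fun s => extChartAt 𝓘(ℝ, E) c (γ s)) ((chartDeriv E c (γ t)).comp A) t :=
    h.hasFDerivAt
  exact h'.hasDerivAt

omit [FiniteDimensional ℝ E] in
theorem chartDeriv_inverse_eq_iff {c q : M} (hq : q ∈ (chartAt E c).source) {X A : E} :
    (chartDeriv E c q).inverse X = A ↔ X = chartDeriv E c q A := by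
  obtain ⟨e, he⟩ : (chartDeriv E c q).IsInvertible :=
    isInvertible_mfderiv_extChartAt (I := 𝓘(ℝ, E)) (x := c) (y := q) (by simpa using hq)
  rw [← he, ContinuousLinearMap.inverse_equiv]
  exact e.symm_apply_eq

variable [RiemannianBundle (fun q : M => TangentSpace 𝓘(ℝ, E) q)]

omit [FiniteDimensional ℝ E] in
/-- A covariant derivative along a curve, computed in the chart at the current point. -/
theorem covDerivAlong_eq_iff {γ : ℝ → M} {V : ℝ → E} {t : ℝ} {A : E} :
    covDerivAlong (E := E) γ V t = A ↔
      deriv (fun s => chartDeriv E (γ t) (γ s) (V s)) t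
        + christoffel (γ t) (extChartAt 𝓘(ℝ, E) (γ t) (γ t))
          (deriv (fun s => extChartAt 𝓘(ℝ, E) (γ t) (γ s)) t) (chartDeriv E (γ t) (γ t) (V t))
        = chartDeriv E (γ t) (γ t) A :=
  chartDeriv_inverse_eq_iff (mem_chart_source E (γ t))

variable [IsContMDiffRiemannianBundle 𝓘(ℝ, E) ∞ E (fun q : M => TangentSpace 𝓘(ℝ, E) q)]

section

variable {κ : ℝ → ℝ} {σ : ℝ → M × E × E} {J : Set ℝ}

/-- Solutions are smooth, by bootstrapping in a chart. -/
theorem IsFrenetOn.contDiffAt_stateCoord (hκ : ContDiff ℝ ∞ κ) (h : IsFrenetOn κ σ J)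
    (hJ : IsOpen J) {t : ℝ} (ht : t ∈ J) {c : M} (hc : (σ t).1 ∈ (chartAt E c).source) :
    ContDiffAt ℝ ∞ (stateCoord c ∘ σ) t := by
  refine ode_contDiffAt (contDiffOn_frenetField hκ c) ?_
  filter_upwards [h.eventually_hasDerivAt hJ ht hc, h.eventually_mem_source ht hc] with s hs hs'
  exact ⟨stateCoord_mem_stateDomain hs', hs⟩

theorem IsFrenetOn.contMDiffAt (hκ : ContDiff ℝ ∞ κ) (h : IsFrenetOn κ σ J)
    (hJ : IsOpen J) {t : ℝ} (ht : t ∈ J) :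
    ContMDiffAt 𝓘(ℝ, ℝ) 𝓘(ℝ, E) ∞ (fun s => (σ s).1) t := by
  set c := (σ t).1 with hcdef
  have hc : (σ t).1 ∈ (chartAt E c).source := mem_chart_source E c
  have h1 : ContMDiffAt 𝓘(ℝ, ℝ) 𝓘(ℝ, E) ∞ (fun s => (stateCoord c (σ s)).1) t :=
    (h.contDiffAt_stateCoord hκ hJ ht hc).fst.contMDiffAt
  have h2 : ContMDiffAt 𝓘(ℝ, E) 𝓘(ℝ, E) ∞ (extChartAt 𝓘(ℝ, E) c).symm (stateCoord c (σ t)).1 :=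
    contMDiffAt_extChartAt_symm' (stateCoord_mem_stateDomain hc)
  refine (h2.comp t h1).congr_of_eventuallyEq ?_
  filter_upwards [h.eventually_mem_source ht hc] with s hs
  exact ((extChartAt 𝓘(ℝ, E) c).left_inv (by simpa using hs)).symm

theorem IsFrenetOn.contMDiffAt_field (hκ : ContDiff ℝ ∞ κ) (h : IsFrenetOn κ σ J)
    (hJ : IsOpen J) {t : ℝ} (ht : t ∈ J) :
    ContMDiffAt 𝓘(ℝ, ℝ) 𝓘(ℝ, E).tangent ∞
      (fun s => (⟨(σ s).1, (σ s).2.2⟩ : TangentBundle 𝓘(ℝ, E) M)) t := by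
  obtain ⟨O, hO, hOo, htO⟩ := _root_.mem_nhds_iff.1
    (inter_mem (hJ.mem_nhds ht) (h.eventually_mem_source ht (mem_chart_source E (σ t).1)))
  refine ((contMDiffOn_tangentBundle_iff (c := (σ t).1) fun s hs => (hO hs).2).2 ⟨?_, ?_⟩
    ).contMDiffAt (hOo.mem_nhds htO)
  · exact fun s hs => (h.contMDiffAt hκ hJ (hO hs).1).contMDiffWithinAt
  · exact fun s hs =>
      (h.contDiffAt_stateCoord hκ hJ (hO hs).1 (hO hs).2).snd.snd.contDiffWithinAt

theorem IsFrenetOn.velocity_eq (hκ : ContDiff ℝ ∞ κ) (h : IsFrenetOn κ σ J)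
    (hJ : IsOpen J) {t : ℝ} (ht : t ∈ J) : modelVelocity E (fun s => (σ s).1) t = (σ t).2.1 := by
  have hc := mem_chart_source E (σ t).1
  have h1 := hasDerivAt_extChartAt_comp (c := (σ t).1)
    ((h.contMDiffAt hκ hJ ht).mdifferentiableAt (by simp)) hc
  have h2 : HasDerivAt (fun s => extChartAt 𝓘(ℝ, E) (σ t).1 (σ s).1)
    (chartDeriv E (σ t).1 (σ t).1 (σ t).2.1) t := (h.hasDerivAt t ht _ hc).fst
  have h3 := congrArg (chartSymmDeriv (σ t).1 (extChartAt 𝓘(ℝ, E) (σ t).1 (σ t).1)) (h1.unique h2)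
  rwa [chartSymmDeriv_chartDeriv hc, chartSymmDeriv_chartDeriv hc] at h3

omit [FiniteDimensional ℝ E]
  [IsContMDiffRiemannianBundle 𝓘(ℝ, E) ∞ E (fun q : M => TangentSpace 𝓘(ℝ, E) q)] in
/-- The covariant derivatives of `T` and `Y` along a solution. -/
theorem IsFrenetOn.covDerivAlong_eq (h : IsFrenetOn κ σ J) {t : ℝ} (ht : t ∈ J) :
    covDerivAlong (E := E) (fun s => (σ s).1) (fun s => (σ s).2.1) t = κ t • (σ t).2.2 ∧
      covDerivAlong (E := E) (fun s => (σ s).1) (fun s => (σ s).2.2) t = -κ t • (σ t).2.1 := by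
  have hd := h.hasDerivAt t ht _ (mem_chart_source E (σ t).1)
  have hz : HasDerivAt (fun s => extChartAt 𝓘(ℝ, E) (σ t).1 (σ s).1)
    (frenetField κ (σ t).1 t (stateCoord (σ t).1 (σ t))).1 t := hd.fst
  have hv : HasDerivAt (fun s => chartDeriv E (σ t).1 (σ s).1 (σ s).2.1)
    (frenetField κ (σ t).1 t (stateCoord (σ t).1 (σ t))).2.1 t := hd.snd.fst
  have hw : HasDerivAt (fun s => chartDeriv E (σ t).1 (σ s).1 (σ s).2.2)
    (frenetField κ (σ t).1 t (stateCoord (σ t).1 (σ t))).2.2 t := hd.snd.snd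
  constructor
  · rw [covDerivAlong_eq_iff, hz.deriv, hv.deriv, map_smul]
    exact sub_add_cancel _ _
  · rw [covDerivAlong_eq_iff, hz.deriv, hw.deriv, map_smul]
    exact sub_add_cancel _ _

end

/-- A solution of the system on `ℝ` that starts at an orthonormal pair is a planar curve. -/
theorem IsFrenetOn.isPlanarWith {κ : ℝ → ℝ} (hκ : ContDiff ℝ ∞ κ) {σ : ℝ → M × E × E}
    (h : IsFrenetOn κ σ univ) (h₁ : tangentInner (σ 0).1 (σ 0).2.1 (σ 0).2.1 = 1)
    (h₂ : tangentInner (σ 0).1 (σ 0).2.2 (σ 0).2.2 = 1)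
    (h₃ : tangentInner (σ 0).1 (σ 0).2.1 (σ 0).2.2 = 0) :
    IsPlanarWith (E := E) κ (fun t => (σ t).1) (fun t => (σ t).2.2) := by
  have hvel : velocity E (fun s => (σ s).1) = fun t => (σ t).2.1 :=
    funext fun t => h.velocity_eq hκ isOpen_univ (mem_univ t)
  have hunit (t : ℝ) := h.tangentInner_self_eq_one isOpen_univ isPreconnected_univ (mem_univ 0)
    h₁ h₂ h₃ (mem_univ t)
  refine ⟨fun t => h.contMDiffAt hκ isOpen_univ (mem_univ t), fun t => ?_,
    fun t => h.contMDiffAt_field hκ isOpen_univ (mem_univ t), fun t => ?_, fun t => ?_, fun t => ?_⟩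
  · rw [hvel]; exact tangentInner_self_eq_one_iff.1 (hunit t).1
  · exact tangentInner_self_eq_one_iff.1 (hunit t).2
  · rw [hvel]; exact (h.covDerivAlong_eq (mem_univ t)).1
  · rw [hvel]; exact (h.covDerivAlong_eq (mem_univ t)).2

/-- A planar curve with its tangent field and its unit field solves the system. -/
theorem IsPlanarWith.isFrenetOn {κ : ℝ → ℝ} {γ : ℝ → M} {Y : ℝ → E}
    (h : IsPlanarWith (E := E) κ γ Y) :
    IsFrenetOn (E := E) κ (fun t => (γ t, modelVelocity E γ t, Y t)) univ := by
  have hcont := h.smooth.continuous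
  refine ⟨fun t _ => hcont.continuousAt, fun t _ c hc => ?_⟩
  refine hasDerivAt_stateCoord_change (c := γ t) hcont.continuousAt (mem_chart_source E (γ t)) hc ?_
  set O : Set ℝ := γ ⁻¹' (chartAt E (γ t)).source with hOdef
  have hO : IsOpen O := (chartAt E (γ t)).open_source.preimage hcont
  have htO : t ∈ O := mem_chart_source E (γ t)
  have hz : ∀ s ∈ O, HasDerivAt (fun s => extChartAt 𝓘(ℝ, E) (γ t) (γ s))
      (chartDeriv E (γ t) (γ s) (modelVelocity E γ s)) s := fun s hs =>
    hasDerivAt_extChartAt_comp (h.smooth.contMDiffAt.mdifferentiableAt (by simp)) hs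
  have hzs : ContDiffAt ℝ ∞ (fun s => extChartAt 𝓘(ℝ, E) (γ t) (γ s)) t :=
    (ContMDiffAt.comp (I' := 𝓘(ℝ, E)) t (contMDiffAt_extChartAt' htO)
      h.smooth.contMDiffAt).contDiffAt
  have hv : DifferentiableAt ℝ (fun s => chartDeriv E (γ t) (γ s) (modelVelocity E γ s)) t := by
    have h1 : DifferentiableAt ℝ (deriv fun s => extChartAt 𝓘(ℝ, E) (γ t) (γ s)) t :=
      (hzs.derivWithin (m := ∞) (by norm_cast)).differentiableAt (by simp)
    refine h1.congr_of_eventuallyEq ?_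
    filter_upwards [hO.mem_nhds htO] with s hs
    exact (hz s hs).deriv.symm
  have hY : ContMDiffOn 𝓘(ℝ, ℝ) 𝓘(ℝ, E).tangent ∞
      (fun s => (⟨γ s, Y s⟩ : TangentBundle 𝓘(ℝ, E) M)) O := h.smooth_field.contMDiffOn
  have hw : DifferentiableAt ℝ (fun s => chartDeriv E (γ t) (γ s) (Y s)) t :=
    (((contMDiffOn_tangentBundle_iff (c := γ t) (γ := γ) (V := Y) (s := O)
      fun s hs => hs).1 hY).2.contDiffAt (hO.mem_nhds htO)).differentiableAt (by simp)
  have h1 := (covDerivAlong_eq_iff (V := modelVelocity E γ) (A := κ t • Y t)).1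
    (h.covDeriv_velocity t)
  have h2 := (covDerivAlong_eq_iff (A := -κ t • modelVelocity E γ t)).1 (h.covDeriv_field t)
  rw [(hz t htO).deriv, map_smul, ← eq_sub_iff_add_eq] at h1 h2
  refine ((hz t htO).prodMk (hv.hasDerivAt.prodMk hw.hasDerivAt)).congr_deriv ?_
  rw [h1, h2]
  rfl

end Planar

/-! ### Global existence on complete manifolds -/

section Glue

variable {E : Type*} [NormedAddCommGroup E] [NormedSpace ℝ E] [FiniteDimensional ℝ E]
  {M : Type*} [TopologicalSpace M] [T2Space M] [ChartedSpace E M] [IsManifold 𝓘(ℝ, E) ∞ M]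
  [RiemannianBundle (fun q : M => TangentSpace 𝓘(ℝ, E) q)]
  [IsContMDiffRiemannianBundle 𝓘(ℝ, E) ∞ E (fun q : M => TangentSpace 𝓘(ℝ, E) q)]

theorem isPreconnected_inter_real {J J' : Set ℝ} (h : IsPreconnected J) (h' : IsPreconnected J') :
    IsPreconnected (J ∩ J') :=
  (h.ordConnected.inter h'.ordConnected).isPreconnected

omit [FiniteDimensional ℝ E] [T2Space M] [IsManifold 𝓘(ℝ, E) ∞ M]
  [IsContMDiffRiemannianBundle 𝓘(ℝ, E) ∞ E (fun q : M => TangentSpace 𝓘(ℝ, E) q)] in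
theorem isFrenetOn_sUnion {κ : ℝ → ℝ} {σ : ℝ → M × E × E} {𝒥 : Set (Set ℝ)}
    (h : ∀ J ∈ 𝒥, IsFrenetOn κ σ J) : IsFrenetOn κ σ (⋃₀ 𝒥) := by
  refine ⟨fun t ht => ?_, fun t ht => ?_⟩ <;> obtain ⟨J, hJ, ht⟩ := ht
  · exact (h J hJ).continuousAt t ht
  · exact (h J hJ).hasDerivAt t ht

/-- The open intervals around `0` on which there is a solution with initial state `s`. -/
def solutionIntervals (κ : ℝ → ℝ) (s : M × E × E) : Set (Set ℝ) :=
  {J | IsOpen J ∧ IsPreconnected J ∧ 0 ∈ J ∧ ∃ σ : ℝ → M × E × E, IsFrenetOn κ σ J ∧ σ 0 = s}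

/-- By uniqueness, solutions on different intervals fit together. -/
theorem sUnion_mem_solutionIntervals {κ : ℝ → ℝ} (hκ : ContDiff ℝ ∞ κ) {s : M × E × E}
    (hne : (solutionIntervals κ s).Nonempty) :
    ⋃₀ solutionIntervals κ s ∈ solutionIntervals κ s := by
  have hex (t : ℝ) : ∃ J ∈ solutionIntervals κ s, t ∈ ⋃₀ solutionIntervals κ s → t ∈ J := by
    by_cases ht : t ∈ ⋃₀ solutionIntervals κ s
    · obtain ⟨J, hJ, htJ⟩ := ht
      exact ⟨J, hJ, fun _ => htJ⟩
    · exact ⟨_, hne.some_mem, fun h => absurd h ht⟩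
  choose J hJ htJ using hex
  choose σ hσ hσ0 using fun t => (hJ t).2.2.2
  -- the solution on the union takes, at time `t`, the value of any solution defined at `t`
  have hglue : ∀ I ∈ solutionIntervals κ s, IsFrenetOn κ (fun t => σ t t) I := by
    rintro I hI
    obtain ⟨hIo, hIp, hI0, τ, hτ, hτ0⟩ := id hI
    refine hτ.congr hIo fun t ht => ?_
    exact ((hσ t).mono inter_subset_left).eqOn hκ ((hJ t).1.inter hIo)
      (isPreconnected_inter_real (hJ t).2.1 hIp) (hτ.mono inter_subset_right)
      ⟨(hJ t).2.2.1, hI0⟩ ((hσ0 t).trans hτ0.symm) ⟨htJ t ⟨I, hI, ht⟩, ht⟩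
  refine ⟨isOpen_sUnion fun I hI => hI.1, isPreconnected_sUnion 0 _ (fun I hI => hI.2.2.1)
    fun I hI => hI.2.1, ?_, fun t => σ t t, isFrenetOn_sUnion hglue, hσ0 0⟩
  obtain ⟨I, hI⟩ := hne
  exact ⟨I, hI, hI.2.2.1⟩

open Classical in
/-- A solution is prolonged by another one that agrees with it at one common time. -/
theorem union_mem_solutionIntervals {κ : ℝ → ℝ} (hκ : ContDiff ℝ ∞ κ) {s : M × E × E}
    {J J' : Set ℝ} (hJ : IsOpen J) (hJp : IsPreconnected J) (hJ0 : 0 ∈ J) {σ τ : ℝ → M × E × E}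
    (hσ : IsFrenetOn κ σ J) (hσ0 : σ 0 = s) (hJ' : IsOpen J') (hJp' : IsPreconnected J')
    (hτ : IsFrenetOn κ τ J') {t₀ : ℝ} (ht₀ : t₀ ∈ J) (ht₀' : t₀ ∈ J') (h : σ t₀ = τ t₀) :
    J ∪ J' ∈ solutionIntervals κ s := by
  have heq := (hσ.mono inter_subset_left).eqOn hκ (hJ.inter hJ')
    (isPreconnected_inter_real hJp hJp') (hτ.mono inter_subset_right) ⟨ht₀, ht₀'⟩ h
  refine ⟨hJ.union hJ', hJp.union t₀ ht₀ ht₀' hJp', Or.inl hJ0, J.piecewise σ τ, ?_, ?_⟩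
  · rw [← sUnion_pair]
    apply isFrenetOn_sUnion
    rintro I (rfl | rfl)
    · exact hσ.congr hJ (piecewise_eqOn _ _ _)
    · refine hτ.congr hJ' fun t ht => ?_
      by_cases htJ : t ∈ J
      · rw [piecewise_eq_of_mem _ _ _ htJ, heq ⟨htJ, ht⟩]
      · rw [piecewise_eq_of_notMem _ _ _ htJ]
  · rw [piecewise_eq_of_mem _ _ _ hJ0, hσ0]

end Glue

section Complete

variable {E : Type*} [NormedAddCommGroup E] [NormedSpace ℝ E] [FiniteDimensional ℝ E]
  {M : Type*} [EMetricSpace M] [ChartedSpace E M] [IsManifold 𝓘(ℝ, E) ∞ M]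
  [RiemannianBundle (fun q : M => TangentSpace 𝓘(ℝ, E) q)]
  [IsContMDiffRiemannianBundle 𝓘(ℝ, E) ∞ E (fun q : M => TangentSpace 𝓘(ℝ, E) q)]
  [IsRiemannianManifold 𝓘(ℝ, E) M]

omit [FiniteDimensional ℝ E] [IsManifold 𝓘(ℝ, E) ∞ M]
  [IsContMDiffRiemannianBundle 𝓘(ℝ, E) ∞ E (fun q : M => TangentSpace 𝓘(ℝ, E) q)] in
/-- A curve of unit speed does not increase distances. -/
theorem lipschitzOnWith_of_unit_speed {γ : ℝ → M} {J : Set ℝ} (hJ : J.OrdConnected)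
    (hγ : ∀ t ∈ J, ContMDiffAt 𝓘(ℝ, ℝ) 𝓘(ℝ, E) 1 γ t) (hv : ∀ t ∈ J, ‖velocity E γ t‖ = 1) :
    LipschitzOnWith 1 γ J := by
  have hle : ∀ s ∈ J, ∀ t ∈ J, s ≤ t → edist (γ s) (γ t) ≤ edist s t := by
    intro s hs t ht hst
    have hsub := hJ.out hs ht
    rw [IsRiemannianManifold.out (I := 𝓘(ℝ, E)) (γ s) (γ t)]
    refine (Manifold.riemannianEDist_le_pathELength (I := 𝓘(ℝ, E)) (γ := γ) (a := s) (b := t)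
      (fun r hr => (hγ r (hsub hr)).contMDiffWithinAt) rfl rfl hst).trans ?_
    rw [Manifold.pathELength_eq_lintegral_mfderiv_Icc]
    have : ∀ r ∈ Icc s t, ‖mfderiv 𝓘(ℝ, ℝ) 𝓘(ℝ, E) γ r (1 : ℝ)‖ₑ = 1 := by
      intro r hr
      have h1 := hv r (hsub hr)
      rw [← ofReal_norm]
      rw [velocity] at h1
      rw [h1, ENNReal.ofReal_one]
    refine (MeasureTheory.setLIntegral_congr_fun measurableSet_Icc this).trans_le ?_
    simp [edist_dist, Real.dist_eq, abs_of_nonpos (sub_nonpos.2 hst)]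
  intro s hs t ht
  rw [ENNReal.coe_one, one_mul]
  rcases le_total s t with h | h
  · exact hle s hs t ht h
  · rw [edist_comm, edist_comm s]; exact hle t ht s hs h

/-- On a complete manifold, the system has a solution on `ℝ` for every orthonormal initial pair. -/
theorem exists_isFrenetOn_univ [CompleteSpace M] {κ : ℝ → ℝ} (hκ : ContDiff ℝ ∞ κ)
    {s : M × E × E} (h₁ : tangentInner s.1 s.2.1 s.2.1 = 1)
    (h₂ : tangentInner s.1 s.2.2 s.2.2 = 1) (h₃ : tangentInner s.1 s.2.1 s.2.2 = 0) :
    ∃ σ : ℝ → M × E × E, IsFrenetOn κ σ univ ∧ σ 0 = s := by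
  have hne : (solutionIntervals κ s).Nonempty := by
    obtain ⟨ε, hε, U, hU, h⟩ := exists_isFrenetOn_uniform (E := E) hκ s.1 0
    obtain ⟨σ, hσ, hσ0⟩ := h 0 (mem_closedBall_self zero_le_one) s (mem_of_mem_nhds hU) h₁ h₂
    exact ⟨_, isOpen_Ioo, isPreconnected_Ioo, by constructor <;> linarith, σ, hσ, hσ0⟩
  obtain ⟨hUo, hUp, hU0, σ, hσ, hσ0⟩ := sUnion_mem_solutionIntervals hκ hne
  set U := ⋃₀ solutionIntervals κ s with hUdef
  have hunit (t : ℝ) (ht : t ∈ U) := hσ.tangentInner_self_eq_one hUo hUp hU0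
    (by rwa [hσ0]) (by rwa [hσ0])
    (by rwa [hσ0]) ht
  have hlip : LipschitzOnWith 1 (fun t => (σ t).1) U := by
    refine lipschitzOnWith_of_unit_speed (E := E) hUp.ordConnected
      (fun t ht => (hσ.contMDiffAt hκ hUo ht).of_le (by norm_cast)) fun t ht => ?_
    have hvel := hσ.velocity_eq hκ hUo ht
    have := (hunit t ht).1
    rw [← hvel] at this
    exact tangentInner_self_eq_one_iff.1 this
  have hclosed : closure U ⊆ U := by
    intro b hb
    have : (𝓝[U] b).NeBot := mem_closure_iff_nhdsWithin_neBot.1 hb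
    -- the curve has a limit at `b`, since it is Lipschitz and the manifold is complete
    have hcauchy : Cauchy (map (fun t => (σ t).1) (𝓝[U] b)) :=
      (cauchy_nhds.mono nhdsWithin_le_nhds).map_of_le hlip.uniformContinuousOn
        (le_principal_iff.2 self_mem_nhdsWithin)
    obtain ⟨q, hq⟩ := CompleteSpace.complete hcauchy
    obtain ⟨ε, hε, V, hV, h⟩ := exists_isFrenetOn_uniform (E := E) hκ q b
    have hev : ∀ᶠ t in 𝓝[U] b, (t ∈ U ∧ (σ t).1 ∈ V) ∧ t ∈ ball b (min ε 1) :=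
      (eventually_mem_nhdsWithin.and (hq hV)).and
        (mem_nhdsWithin_of_mem_nhds (ball_mem_nhds b (by positivity)))
    obtain ⟨t₀, ⟨ht₀U, ht₀V⟩, ht₀⟩ := hev.exists
    have hdist : dist t₀ b < min ε 1 := ht₀
    obtain ⟨τ, hτ, hτ0⟩ := h t₀ (hdist.le.trans (min_le_right _ _)) (σ t₀) ht₀V
      (hunit t₀ ht₀U).1 (hunit t₀ ht₀U).2
    have hunion := union_mem_solutionIntervals hκ hUo hUp hU0 hσ hσ0 isOpen_Ioo isPreconnected_Ioo
      hτ ht₀U (by constructor <;> linarith) hτ0.symm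
    refine subset_sUnion_of_mem hunion (Or.inr ?_)
    have h3 := abs_lt.1 ((Real.dist_eq t₀ b ▸ hdist).trans_le (min_le_left _ _))
    constructor <;> linarith [h3.1, h3.2]
  have huniv : U = univ :=
    IsClopen.eq_univ ⟨isClosed_of_closure_subset hclosed, hUo⟩ ⟨0, hU0⟩
  exact ⟨σ, huniv ▸ hσ, hσ0⟩

end Complete

section Main

variable {E : Type*} [NormedAddCommGroup E] [NormedSpace ℝ E] [FiniteDimensional ℝ E]
  {M : Type*} [TopologicalSpace M] [T2Space M] [ChartedSpace E M] [IsManifold 𝓘(ℝ, E) ∞ M]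
  [RiemannianBundle (fun q : M => TangentSpace 𝓘(ℝ, E) q)]
  [IsContMDiffRiemannianBundle 𝓘(ℝ, E) ∞ E (fun q : M => TangentSpace 𝓘(ℝ, E) q)]

omit [T2Space M] [FiniteDimensional ℝ E] [IsManifold 𝓘(ℝ, E) ∞ M]
  [RiemannianBundle (fun q : M => TangentSpace 𝓘(ℝ, E) q)]
  [IsContMDiffRiemannianBundle 𝓘(ℝ, E) ∞ E (fun q : M => TangentSpace 𝓘(ℝ, E) q)] in
/-- The initial conditions in the tangent bundle as one equality of triples with vectors in the
model space. -/
theorem hasInitialData_iff {p : M} {x y : E} {γ : ℝ → M} {Y : ℝ → E} :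
    HasInitialData (E := E) p x y γ Y ↔ (γ 0, modelVelocity E γ 0, Y 0) = (p, x, y) := by
  have hmk : ∀ {q q' : M} {v v' : E}, q = q' → v = v' →
      (⟨q, v⟩ : TangentBundle 𝓘(ℝ, E) M) = ⟨q', v'⟩ := by
    rintro q _ v _ rfl rfl; rfl
  constructor
  · intro h
    exact Prod.ext h.base (Prod.ext
      (congrArg (fun z : TangentBundle 𝓘(ℝ, E) M => (z.2 : E)) h.velocity_zero)
      (congrArg (fun z : TangentBundle 𝓘(ℝ, E) M => (z.2 : E)) h.field_zero))
  · intro h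
    have h1 : γ 0 = p := congrArg Prod.fst h
    have h2 : modelVelocity E γ 0 = x := congrArg (fun s => s.2.1) h
    have h3 : Y 0 = y := congrArg (fun s => s.2.2) h
    exact ⟨h1, hmk h1 h2, hmk h1 h3⟩

/-- Planar curves with the same function `κ` and the same initial data coincide, with their unit
fields. -/
theorem IsPlanarWith.unique {κ : ℝ → ℝ} (hκ : ContDiff ℝ ∞ κ) {p : M} {x y : E} {γ γ' : ℝ → M}
    {Y Y' : ℝ → E} (h : IsPlanarWith (E := E) κ γ Y) (h0 : HasInitialData (E := E) p x y γ Y)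
    (h' : IsPlanarWith (E := E) κ γ' Y') (h0' : HasInitialData (E := E) p x y γ' Y') :
    γ = γ' ∧ Y = Y' := by
  have heq := h.isFrenetOn.eqOn hκ isOpen_univ isPreconnected_univ h'.isFrenetOn (mem_univ 0)
    ((hasInitialData_iff.1 h0).trans (hasInitialData_iff.1 h0').symm)
  exact ⟨funext fun t => congrArg Prod.fst (heq (mem_univ t)),
    funext fun t => congrArg (fun s => s.2.2) (heq (mem_univ t))⟩

end Main

end PlanarCurve

end

theorem mainTheorem8
    {E : Type*} [NormedAddCommGroup E] [NormedSpace ℝ E] [FiniteDimensional ℝ E]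
    {M : Type*} [EMetricSpace M] [ChartedSpace E M] [IsManifold 𝓘(ℝ, E) ∞ M]
    [RiemannianBundle (fun q : M => TangentSpace 𝓘(ℝ, E) q)]
    [IsContMDiffRiemannianBundle 𝓘(ℝ, E) ∞ E (fun q : M => TangentSpace 𝓘(ℝ, E) q)]
    [IsRiemannianManifold 𝓘(ℝ, E) M] [CompleteSpace M]
    (p : M) (x y : TangentSpace 𝓘(ℝ, E) p) (hxy : Orthonormal ℝ ![x, y])
    (κ : ℝ → ℝ) (hκ : ContDiff ℝ ∞ κ) :
    (∃! γ : ℝ → M, ∃ Y : ∀ t, TangentSpace 𝓘(ℝ, E) (γ t),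
      PlanarCurve.IsPlanarWith κ γ Y ∧ PlanarCurve.HasInitialData p x y γ Y) ∧
    (∀ (γ : ℝ → M) (Y Y' : ∀ t, TangentSpace 𝓘(ℝ, E) (γ t)),
      PlanarCurve.IsPlanarWith κ γ Y → PlanarCurve.HasInitialData p x y γ Y →
      PlanarCurve.IsPlanarWith κ γ Y' → PlanarCurve.HasInitialData p x y γ Y' → Y = Y') := by
  refine ⟨?_, fun γ Y Y' h h0 h' h0' => (PlanarCurve.IsPlanarWith.unique hκ h h0 h' h0').2⟩
  have hxx : PlanarCurve.tangentInner (E := E) p x x = 1 :=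
    PlanarCurve.tangentInner_self_eq_one_iff.2 (hxy.1 0)
  have hyy : PlanarCurve.tangentInner (E := E) p y y = 1 :=
    PlanarCurve.tangentInner_self_eq_one_iff.2 (hxy.1 1)
  have hxy0 : PlanarCurve.tangentInner (E := E) p x y = 0 :=
    hxy.2 (i := 0) (j := 1) (by decide)
  obtain ⟨σ, hσ, hσ0⟩ := PlanarCurve.exists_isFrenetOn_univ (E := E) (M := M) (s := (p, x, y)) hκ
    hxx hyy hxy0
  have hplanar := hσ.isPlanarWith hκ (by rwa [hσ0]) (by rwa [hσ0]) (by rwa [hσ0])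
  have hinit : PlanarCurve.HasInitialData (E := E) p x y (fun t => (σ t).1)
      (fun t => (σ t).2.2) := by
    refine PlanarCurve.hasInitialData_iff.2 ?_
    rw [hσ.velocity_eq hκ isOpen_univ (Set.mem_univ 0)]
    exact hσ0
  refine ⟨fun t => (σ t).1, ⟨fun t => (σ t).2.2, hplanar, hinit⟩, ?_⟩
  rintro γ ⟨Y, h, h0⟩
  exact (PlanarCurve.IsPlanarWith.unique hκ h h0 hplanar hinit).1
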